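/- Let $(P_t)_{t\ge 0}$ be the transition semigroup (of Markov kernels $P_t(x,dy)$) of a time-homogeneous Markov process on a measurable space $E$, with an invariant probability measure $\mu$. For $p\in\{1,2\}$ write $g=Lf$, $f\in D_p(L)$, if $f,g\in L^p(\mu)$ and $(P_tf-f)/t\to g$ in $L^p(\mu)$ as $t\downarrow 0$. A core is a subset of $D_2(L)$ that is dense in $D_2(L)$ for the graph norm of $L$ in $L^2(\mu)$. Assume that some algebra of bounded measurable functions containing the constants is a core. Put $\Gamma(f,g)=L(fg)-fLg-gLf$ for $f,g\in D_2(L)$ (then $fg\in D_1(L)$), and $\Gamma(f)=\Gamma(f,f)$. Let $\mathcal N$ be a class of "nice" functions, i.e. a core with $P_t\mathcal N\subset\mathcal N$ for all $t\ge0$ such that $Lf\in D_2(L)$ and $\Gamma(f)\in D_1(L)$ for $f\in\mathcal N$; for such $f$ put $\Gamma_2(f)=L\Gamma(f)-2\Gamma(f,Lf)$. For $\rho\in\mathbb R$, the curvature of $L$ is bounded from below by $\rho$ if $\Gamma_2(f)\ge\rho\,\Gamma(f)$ $\mu$-a.e. for all $f\in\mathcal N$. A probability measure $\nu\ll\mu$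 satisfies a weak Poincaré inequality with a non-increasing function $\beta:(0,\infty)\to[0,\infty)$ if $$\mathrm{Var}_\nu(f)\le\beta(s)\int\Gamma(f)\,d\nu+s\,\mathrm{Osc}^2(f)$$ for all $s>0$ and all bounded $f\in D_2(L)$ with $\int\Gamma(f)\,d\nu<\infty$, where $\mathrm{Osc}(f)=\sup f-\inf f$. Let $h$ be a probability density with respect to $\mu$ and let $P_t^*h$ be the density with respect to $\mu$ of $\int P_t(x,\cdot)\,h(x)\,\mu(dx)$, the law at time $t$ of the process with initial law $h\mu$. **Corollary.** If the curvature of $L$ is bounded from below by $\rho\in\mathbb R$ and $h\mu$ satisfies a weak Poincaré inequality with function $\beta_{WP}$, then for every $t\ge 0$ the measure $P_t^*h\,\mu$ satisfies a weak Poincaré inequality with function $$\beta_{WP}(t,s)=\frac{1-e^{-\rho t}}{\rho}+e^{-\rho t}\,\beta_{WP}(s),$$ where $\frac{1-e^{-\rho t}}{\rho}$ is replaced by $t$ if $\rho=0$. -/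

import Mathlib

open MeasureTheory ProbabilityTheory Filter Topology Set
open scoped NNReal ENNReal

/-- The transition semigroup `P_t(x, dy)` of a time-homogeneous Markov process on `E`. -/
structure MarkovSemigroup (E : Type*) [MeasurableSpace E] where
  /-- `kernel t x` is the law at time `t` of the process started at `x` -/
  kernel : ℝ≥0 → Kernel E E
  isMarkov : ∀ t, IsMarkovKernel (kernel t)
  zero : kernel 0 = Kernel.id
  /-- Chapman-Kolmogorov -/
  add : ∀ s t, kernel (s + t) = (kernel t).comp (kernel s)

noncomputable section

namespace MarkovSemigroup

variable {E : Type*} [MeasurableSpace E]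

/-- `P_t f (x) = ∫ f(y) P_t(x, dy)`. -/
def op (P : MarkovSemigroup E) (t : ℝ≥0) (f : E → ℝ) : E → ℝ :=
  fun x => ∫ y, f y ∂(P.kernel t x)

/-- `μ` is invariant for the process. -/
def IsInvariant (P : MarkovSemigroup E) (μ : Measure E) : Prop :=
  ∀ t, (P.kernel t).Invariant μ

/-- `g = L f` in the `L^p(μ)` sense: `(P_t f - f) / t` tends to `g` in `L^p(μ)` as `t ↓ 0`. -/
def IsGen (P : MarkovSemigroup E) (μ : Measure E) (p : ℝ≥0∞) (f g : E → ℝ) : Prop :=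
  MemLp f p μ ∧ MemLp g p μ ∧
    Tendsto (fun t : ℝ≥0 => eLpNorm (fun x => (t : ℝ)⁻¹ * (P.op t f x - f x) - g x) p μ)
      (𝓝[>] 0) (𝓝 0)

/-- The domain `D_p(L)` of the generator in `L^p(μ)`. -/
def dom (P : MarkovSemigroup E) (μ : Measure E) (p : ℝ≥0∞) : Set (E → ℝ) :=
  {f | ∃ g, P.IsGen μ p f g}

open Classical in
/-- The generator `L`, defined on `D_1(L)` up to `μ`-null sets (and `0` off `D_1(L)`). For a finite
measure `μ` it extends the generator in `L^2(μ)`. -/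
def gen (P : MarkovSemigroup E) (μ : Measure E) (f : E → ℝ) : E → ℝ :=
  if h : ∃ g, P.IsGen μ 1 f g then h.choose else 0

/-- The "carré du champ" `Γ(f, g) = L(fg) - f L g - g L f`. -/
def carre (P : MarkovSemigroup E) (μ : Measure E) (f g : E → ℝ) : E → ℝ :=
  fun x => P.gen μ (f * g) x - f x * P.gen μ g x - g x * P.gen μ f x

/-- `Γ₂(f) = L Γ(f, f) - 2 Γ(f, L f)`. As `Γ` is normalized by `Γ(f, f) = L(f²) - 2 f L f`, without
a factor `1/2`, there is no factor `1/2` here either. -/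
def gammaTwo (P : MarkovSemigroup E) (μ : Measure E) (f : E → ℝ) : E → ℝ :=
  fun x => P.gen μ (P.carre μ f f) x - 2 * P.carre μ f (P.gen μ f) x

/-- `S` is a core for the generator in `L^2(μ)`: a subset of its domain `D_2(L)`, dense in it for
the graph norm. -/
def IsCore (P : MarkovSemigroup E) (μ : Measure E) (S : Set (E → ℝ)) : Prop :=
  S ⊆ P.dom μ 2 ∧
    ∀ f ∈ P.dom μ 2, ∀ ε : ℝ≥0∞, 0 < ε → ∃ g ∈ S,
      eLpNorm (f - g) 2 μ < ε ∧ eLpNorm (P.gen μ f - P.gen μ g) 2 μ < ε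

/-- A class `N` of "nice" functions: a core, stable under the semigroup, and on which all the terms
of `Γ₂(f)` make sense. An algebra that is a core and is stable under `L` and all the `P_t` is an
example. -/
structure IsNiceClass (P : MarkovSemigroup E) (μ : Measure E) (N : Set (E → ℝ)) : Prop where
  core : P.IsCore μ N
  op_mem : ∀ f ∈ N, ∀ t, P.op t f ∈ N
  gen_mem : ∀ f ∈ N, P.gen μ f ∈ P.dom μ 2
  carre_mem : ∀ f ∈ N, P.carre μ f f ∈ P.dom μ 1

/-- The curvature of `L` is bounded from below by `ρ`: `Γ₂(f) ≥ ρ Γ(f)` for all nice `f`. -/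
def CurvatureBoundedBelow (P : MarkovSemigroup E) (μ : Measure E) (N : Set (E → ℝ)) (ρ : ℝ) :
    Prop :=
  ∀ f ∈ N, ∀ᵐ x ∂μ, ρ * P.carre μ f f x ≤ P.gammaTwo μ f x

/-- The oscillation `sup f - inf f` of a bounded function. -/
def osc (f : E → ℝ) : ℝ := (⨆ x, f x) - ⨅ x, f x

/-- The probability measure `ν` (absolutely continuous with respect to the invariant measure `μ`)
satisfies a weak Poincaré inequality with function `β`:
`Var_ν(f) ≤ β(s) ∫ Γ(f) dν + s Osc²(f)` for all `s > 0` and all bounded `f ∈ D_2(L)`.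
Nothing is claimed when the integral, of a nonnegative function, is infinite. -/
def WeakPoincare (P : MarkovSemigroup E) (μ ν : Measure E) (β : ℝ → ℝ) : Prop :=
  (∀ s, 0 < s → 0 ≤ β s) ∧ AntitoneOn β (Ioi 0) ∧
    ∀ f : E → ℝ, Measurable f → (∃ C, ∀ x, |f x| ≤ C) → f ∈ P.dom μ 2 →
      Integrable (P.carre μ f f) ν →
        ∀ s, 0 < s → variance f ν ≤ β s * ∫ x, P.carre μ f f x ∂ν + s * osc f ^ 2

end MarkovSemigroup

/-- `h` is a probability density with respect to `μ`. -/
def IsProbDensity {E : Type*} [MeasurableSpace E] (μ : Measure E) (h : E → ℝ) : Prop :=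
  Integrable h μ ∧ (∀ᵐ x ∂μ, 0 ≤ h x) ∧ ∫ x, h x ∂μ = 1

/-- The measure `h μ`. -/
def densityMeasure {E : Type*} [MeasurableSpace E] (μ : Measure E) (h : E → ℝ) : Measure E :=
  μ.withDensity (fun x => ENNReal.ofReal (h x))

namespace MarkovSemigroup

/-- `P_t^* h`: the density with respect to `μ` of the law `∫ P_t(x, ·) h(x) μ(dx)` at time `t` of the
process with initial law `h μ`. -/
def dual {E : Type*} [MeasurableSpace E] (P : MarkovSemigroup E) (μ : Measure E) (t : ℝ≥0)
    (h : E → ℝ) : E → ℝ :=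
  fun x => (((densityMeasure μ h).bind (P.kernel t)).rnDeriv μ x).toReal

end MarkovSemigroup

/-- `(1 - exp (-ρ t)) / ρ`, to be read as `t` when `ρ = 0`. -/
def curvatureCoeff (ρ t : ℝ) : ℝ :=
  if ρ = 0 then t else (1 - Real.exp (-ρ * t)) / ρ

end

/-! Write `ν` for the initial law and `c(t)` for `curvatureCoeff ρ t`. Conditioning on the starting
point splits the variance at time `t` (`variance_comp_kernel`): `Var_{νP_t}(f) = ∫ (P_t(f²) - (P_t
f)²) dν + Var_ν(P_t f)`. The curvature bound yields the gradient bound `Γ(P_t f) ≤ e^{-ρt} P_t Γ(f)`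
(`carreL_le`) and the local Poincaré inequality `P_t(f²) - (P_t f)² ≤ c(t) P_t Γ(f)`
(`local_poincare`). The second controls the first term of the splitting. The weak Poincaré
inequality for `ν`, applied to `P_t f`, controls the other one, thanks to the gradient bound and
`Osc(P_t f) ≤ Osc(f)`.

Both inequalities come from interpolation. The derivative of `e^{-ρs} P_s Γ(P_{t-s} f)` is `e^{-ρs}
P_s (Γ₂ - ρΓ)(P_{t-s} f) ≥ 0`, and that of `P_s((P_{t-s} f)²)` is `P_s Γ(P_{t-s} f)`, which the
gradient bound estimates.

The difficulty is to justify these derivatives: `Γ(f)` is only in `L¹`, and strong continuity of the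
semigroup is not assumed. The product rule `hasDerivWithinAt_apply_sub` therefore asks for vectors
with continuous orbits. Moreover `Γ` is a bounded bilinear map from the graph of the `L²` generator
to `L¹` (`norm_carre_le`), because `Γ(f) ≥ 0` and `∫ Lf dμ = 0`. This boundedness carries the
products from the algebra to `D_2(L)`, and the gradient bound from nice functions to `D_2(L)`. -/

noncomputable section

/-! ### Contraction semigroups, their generators and differentiation of orbits -/

/-- A semigroup of linear contractions, without any continuity assumption in time. -/
structure ContractionSemigroup (X : Type*) [NormedAddCommGroup X] [NormedSpace ℝ X] where
  toFun : ℝ≥0 → X →L[ℝ] X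
  zero_apply : ∀ x, toFun 0 x = x
  add_apply : ∀ s t x, toFun (s + t) x = toFun s (toFun t x)
  norm_apply_le : ∀ t x, ‖toFun t x‖ ≤ ‖x‖

namespace ContractionSemigroup

variable {X : Type*} [NormedAddCommGroup X] [NormedSpace ℝ X]

instance : CoeFun (ContractionSemigroup X) (fun _ => ℝ≥0 → X →L[ℝ] X) := ⟨toFun⟩

variable (T : ContractionSemigroup X)

/-- `y` is the value at `x` of the infinitesimal generator. -/
def IsGenerator (x y : X) : Prop :=
  Tendsto (fun t : ℝ≥0 => (t : ℝ)⁻¹ • (T t x - x)) (𝓝[>] 0) (𝓝 y)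

/-- The orbit of `x` is continuous at time `0`. -/
def IsRegular (x : X) : Prop := Tendsto (fun t => T t x) (𝓝 0) (𝓝 x)

variable {T}

theorem IsGenerator.unique {x y z : X} (h : T.IsGenerator x y) (h' : T.IsGenerator x z) : y = z :=
  tendsto_nhds_unique h h'

theorem IsGenerator.add {x y x' y' : X} (h : T.IsGenerator x y) (h' : T.IsGenerator x' y') :
    T.IsGenerator (x + x') (y + y') := by
  refine (Tendsto.add h h').congr fun t => ?_
  rw [map_add, ← smul_add]; congr 1; abel

theorem IsGenerator.smul {x y : X} (c : ℝ) (h : T.IsGenerator x y) :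
    T.IsGenerator (c • x) (c • y) := by
  refine (Tendsto.const_smul h c).congr fun t => ?_
  rw [map_smul, ← smul_sub, smul_comm]

theorem isGenerator_zero : T.IsGenerator (0 : X) 0 := by
  simp [IsGenerator]

theorem IsGenerator.neg {x y : X} (h : T.IsGenerator x y) : T.IsGenerator (-x) (-y) := by
  simpa using h.smul (-1)

theorem IsGenerator.sub {x y x' y' : X} (h : T.IsGenerator x y) (h' : T.IsGenerator x' y') :
    T.IsGenerator (x - x') (y - y') := by
  simpa only [sub_eq_add_neg] using h.add h'.neg

theorem comm_apply (s t : ℝ≥0) (x : X) : T s (T t x) = T t (T s x) := by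
  rw [← T.add_apply, ← T.add_apply, add_comm]

theorem IsGenerator.apply {x y : X} (h : T.IsGenerator x y) (s : ℝ≥0) :
    T.IsGenerator (T s x) (T s y) := by
  refine (((T s).continuous.tendsto y).comp h).congr fun t => ?_
  simp [comm_apply t s]

theorem isRegular_iff {x : X} : T.IsRegular x ↔ ∀ ε > 0, ∀ᶠ t in 𝓝 (0 : ℝ≥0), ‖T t x - x‖ < ε := by
  simp only [IsRegular, Metric.tendsto_nhds, dist_eq_norm]

theorem isClosed_isRegular : IsClosed {x | T.IsRegular x} := by
  refine isClosed_of_closure_subset fun x hx => isRegular_iff.2 fun ε hε => ?_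
  obtain ⟨y, hy, hxy⟩ := Metric.mem_closure_iff.1 hx (ε / 3) (by positivity)
  filter_upwards [isRegular_iff.1 hy (ε / 3) (by positivity)] with t ht
  have h1 : T t x - x = T t (x - y) + (T t y - y) - (x - y) := by rw [map_sub]; abel
  have h2 := T.norm_apply_le t (x - y)
  rw [dist_eq_norm] at hxy
  calc ‖T t x - x‖ ≤ ‖T t (x - y)‖ + ‖T t y - y‖ + ‖x - y‖ := by
        rw [h1]; exact (norm_sub_le _ _).trans (by gcongr; exact norm_add_le _ _)
    _ < ε := by linarith

theorem IsRegular.apply {x : X} (h : T.IsRegular x) (s : ℝ≥0) : T.IsRegular (T s x) :=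
  (((T s).continuous.tendsto x).comp h).congr fun t => comm_apply s t x

theorem IsRegular.sub {x y : X} (h : T.IsRegular x) (h' : T.IsRegular y) : T.IsRegular (x - y) := by
  simpa [IsRegular] using Tendsto.sub h h'

theorem IsRegular.smul {x : X} (c : ℝ) (h : T.IsRegular x) : T.IsRegular (c • x) := by
  simpa [IsRegular] using Tendsto.const_smul h c

theorem IsGenerator.isRegular_left {x y : X} (h : T.IsGenerator x y) : T.IsRegular x := by
  have h1 : Tendsto (fun t : ℝ≥0 => (t : ℝ)) (𝓝[>] 0) (𝓝 0) :=
    (NNReal.continuous_coe.tendsto' 0 0 rfl).mono_left nhdsWithin_le_nhds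
  have h2 : Tendsto (fun t : ℝ≥0 => T t x) (𝓝[>] 0) (𝓝 x) := by
    have := (h1.smul h).add_const x
    rw [zero_smul, zero_add] at this
    refine this.congr' ?_
    filter_upwards [self_mem_nhdsWithin] with t ht
    have : (t : ℝ) ≠ 0 := by exact_mod_cast (ne_of_gt ht)
    rw [smul_smul, mul_inv_cancel₀ this, one_smul, sub_add_cancel]
  have h3 : ContinuousWithinAt (fun t : ℝ≥0 => T t x) (Ioi 0) 0 := by
    simpa [ContinuousWithinAt, T.zero_apply] using h2
  -- In `ℝ≥0` a right neighbourhood of `0` is a full neighbourhood.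
  have h4 := continuousWithinAt_Ioi_iff_Ici.1 h3
  have h5 : Ici (0 : ℝ≥0) = univ := by ext; simp
  rw [h5, continuousWithinAt_univ] at h4
  simpa [ContinuousAt, T.zero_apply, IsRegular] using h4

/-- The difference quotients are regular, and regular vectors form a closed set. This replaces
strong continuity wherever a generator is applied. -/
theorem IsGenerator.isRegular_right {x y : X} (h : T.IsGenerator x y) : T.IsRegular y :=
  T.isClosed_isRegular.mem_of_tendsto h (Eventually.of_forall fun t =>
    ((h.isRegular_left.apply t).sub h.isRegular_left).smul _)

theorem continuous_nnabs : Continuous Real.nnabs :=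
  continuous_abs.subtype_mk fun x => abs_nonneg x

theorem norm_sub_le (s t : ℝ≥0) (x : X) :
    ‖T s x - T t x‖ ≤ ‖T (Real.nnabs ((s : ℝ) - t)) x - x‖ := by
  wlog hst : t ≤ s generalizing s t
  · rw [norm_sub_rev]
    refine (this t s (le_of_not_ge hst)).trans_eq ?_
    have : Real.nnabs ((t : ℝ) - s) = Real.nnabs ((s : ℝ) - t) := by
      ext; simp [abs_sub_comm]
    rw [this]
  obtain ⟨r, rfl⟩ := exists_add_of_le hst
  have : Real.nnabs (((t + r : ℝ≥0) : ℝ) - t) = r := by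
    ext; simp
  rw [this, T.add_apply, ← map_sub]
  exact T.norm_apply_le _ _

theorem IsRegular.continuous {x : X} (h : T.IsRegular x) : Continuous fun t => T t x := by
  refine continuous_iff_continuousAt.2 fun t => ?_
  rw [ContinuousAt, tendsto_iff_norm_sub_tendsto_zero]
  refine squeeze_zero (fun _ => norm_nonneg _) (fun s => norm_sub_le s t x) ?_
  have h1 : Tendsto (fun s : ℝ≥0 => Real.nnabs ((s : ℝ) - t)) (𝓝 t) (𝓝 0) :=
    (continuous_nnabs.comp (by fun_prop)).tendsto' _ _ (by simp)
  exact tendsto_iff_norm_sub_tendsto_zero.1 (h.comp h1)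

theorem IsRegular.continuous_toNNReal {x : X} (h : T.IsRegular x) :
    Continuous fun t : ℝ => T t.toNNReal x :=
  h.continuous.comp continuous_real_toNNReal

theorem IsGenerator.isLittleO {x y : X} (h : T.IsGenerator x y) {ε : ℝ} (hε : 0 < ε) :
    ∀ᶠ r in 𝓝 (0 : ℝ≥0), ‖T r x - x - (r : ℝ) • y‖ ≤ ε * r := by
  have h1 : ∀ᶠ r in 𝓝[>] (0 : ℝ≥0), ‖T r x - x - (r : ℝ) • y‖ ≤ ε * r := by
    filter_upwards [Metric.tendsto_nhds.1 h ε hε, self_mem_nhdsWithin] with r hr hr0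
    have hr1 : (0 : ℝ) < r := by exact_mod_cast hr0
    rw [dist_eq_norm] at hr
    have : T r x - x - (r : ℝ) • y = (r : ℝ) • ((r : ℝ)⁻¹ • (T r x - x) - y) := by
      rw [smul_sub, smul_smul, mul_inv_cancel₀ hr1.ne', one_smul]
    rw [this, norm_smul, Real.norm_of_nonneg hr1.le, mul_comm]
    gcongr
  rw [eventually_nhdsWithin_iff] at h1
  filter_upwards [h1] with r hr
  rcases eq_or_lt_of_le (zero_le : 0 ≤ r) with h0 | h0
  · rw [← h0]; simp [T.zero_apply]
  · exact hr h0

/-- The orbit of a point of the domain of the generator is differentiable. -/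
theorem IsGenerator.hasDerivWithinAt {x y : X} (h : T.IsGenerator x y) {s : ℝ} (hs : 0 ≤ s) :
    HasDerivWithinAt (fun t : ℝ => T t.toNNReal x) (T s.toNNReal y) (Ici 0) s := by
  rw [hasDerivWithinAt_iff_isLittleO, Asymptotics.isLittleO_iff]
  intro ε hε
  have hm : Tendsto (fun t : ℝ => Real.nnabs (t - s)) (𝓝[Ici 0] s) (𝓝 0) :=
    ((continuous_nnabs.comp (continuous_sub_right s)).tendsto' s 0
      (by simp)).mono_left nhdsWithin_le_nhds
  filter_upwards [hm.eventually (h.isLittleO (half_pos hε)),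
    hm.eventually (isRegular_iff.1 h.isRegular_right (ε / 2) (half_pos hε)),
    self_mem_nhdsWithin] with t h1 h2 (ht : 0 ≤ t)
  rcases le_total s t with hst | hst
  · obtain ⟨r, hr, rfl⟩ : ∃ r, 0 ≤ r ∧ t = s + r := ⟨t - s, by linarith, by ring⟩
    lift r to ℝ≥0 using hr
    lift s to ℝ≥0 using hs
    have e : Real.nnabs ((s : ℝ) + r - s) = r := by ext; simp
    rw [e] at h1
    have e1 : ((s : ℝ) + r).toNNReal = s + r := by rw [← NNReal.coe_add, Real.toNNReal_coe]
    rw [e1, Real.toNNReal_coe, add_sub_cancel_left, T.add_apply]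
    calc _ = ‖T s (T r x - x - (r : ℝ) • y)‖ := by simp only [map_sub, map_smul]
      _ ≤ ε / 2 * r := (T.norm_apply_le _ _).trans h1
      _ ≤ ε * ‖(r : ℝ)‖ := by
        rw [NNReal.norm_eq]
        gcongr
        linarith
  -- For the left derivative `T t` is factored out; the error `r • (T r y - y)` that this creates is
  -- small because `y` is regular.
  · obtain ⟨r, hr, rfl⟩ : ∃ r, 0 ≤ r ∧ s = t + r := ⟨s - t, by linarith, by ring⟩
    lift r to ℝ≥0 using hr
    lift t to ℝ≥0 using ht
    have e : Real.nnabs ((t : ℝ) - (t + r)) = r := by ext; simp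
    rw [e] at h1 h2
    have e1 : ((t : ℝ) + r).toNNReal = t + r := by rw [← NNReal.coe_add, Real.toNNReal_coe]
    rw [e1, Real.toNNReal_coe, T.add_apply, T.add_apply]
    have e2 : T t x - T t (T r x) - ((t : ℝ) - (t + r)) • T t (T r y)
        = T t ((r : ℝ) • (T r y - y) - (T r x - x - (r : ℝ) • y)) := by
      simp only [map_sub, map_smul]
      module
    rw [e2]
    have e3 : ‖(t : ℝ) - (t + r)‖ = r := by simp
    rw [e3]
    calc _ ≤ ‖(r : ℝ) • (T r y - y)‖ + ‖T r x - x - (r : ℝ) • y‖ :=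
          (T.norm_apply_le _ _).trans (_root_.norm_sub_le _ _)
      _ ≤ r * (ε / 2) + ε / 2 * r := by
        rw [norm_smul, NNReal.norm_eq]
        gcongr
      _ = ε * r := by ring

/-- The generator is a closed operator. -/
theorem isGenerator_of_tendsto {u v : ℕ → X} {x y : X} (h : ∀ n, T.IsGenerator (u n) (v n))
    (hu : Tendsto u atTop (𝓝 x)) (hv : Tendsto v atTop (𝓝 y)) : T.IsGenerator x y := by
  have hy : T.IsRegular y :=
    T.isClosed_isRegular.mem_of_tendsto hv (Eventually.of_forall fun n => (h n).isRegular_right)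
  rw [IsGenerator, Metric.tendsto_nhds]
  intro ε hε
  have h0 := isRegular_iff.1 hy (ε / 2) (half_pos hε)
  obtain ⟨δ, hδ, hδ'⟩ := Metric.eventually_nhds_iff.1 h0
  have hnear : ∀ᶠ t : ℝ≥0 in 𝓝[>] 0, dist t 0 < δ :=
    (Metric.eventually_nhds_iff.2 ⟨δ, hδ, fun _ h => h⟩).filter_mono nhdsWithin_le_nhds
  filter_upwards [hnear, self_mem_nhdsWithin] with t ht ht0
  have ht1 : (0 : ℝ) < t := by exact_mod_cast ht0
  -- The mean value inequality gives an estimate on a time interval independent of `n`, so that `n →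
  -- ∞` can be taken at fixed `t`.
  have key : ∀ n, ‖T t (u n) - u n - (t : ℝ) • v n‖ ≤ (ε / 2 + 2 * ‖v n - y‖) * t := by
    intro n
    have hd : ∀ s ∈ Icc (0 : ℝ) t, HasDerivWithinAt
        (fun s : ℝ => T s.toNNReal (u n) - s • v n) (T s.toNNReal (v n) - v n) (Icc 0 (t : ℝ)) s := by
      intro s hs
      have := ((h n).hasDerivWithinAt hs.1).mono (Icc_subset_Ici_self : Icc 0 (t : ℝ) ⊆ Ici 0)
      have h' := this.sub ((hasDerivWithinAt_id s _).smul_const (v n))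
      rw [one_smul] at h'
      exact h'
    have hb : ∀ s ∈ Ico (0 : ℝ) t, ‖T s.toNNReal (v n) - v n‖ ≤ ε / 2 + 2 * ‖v n - y‖ := by
      intro s hs
      have e : T s.toNNReal (v n) - v n
          = T s.toNNReal (v n - y) + (T s.toNNReal y - y) - (v n - y) := by
        rw [map_sub]; abel
      have h1 := T.norm_apply_le s.toNNReal (v n - y)
      have h2 : ‖T s.toNNReal y - y‖ < ε / 2 := by
        apply hδ'
        rw [NNReal.dist_eq] at ht ⊢
        rw [Real.coe_toNNReal _ hs.1]
        simp only [NNReal.coe_zero, sub_zero] at ht ⊢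
        rw [abs_of_nonneg hs.1]
        exact hs.2.trans ((le_abs_self _).trans_lt ht)
      calc _ ≤ ‖T s.toNNReal (v n - y)‖ + ‖T s.toNNReal y - y‖ + ‖v n - y‖ := by
            rw [e]; exact (_root_.norm_sub_le _ _).trans (by gcongr; exact norm_add_le _ _)
        _ ≤ _ := by linarith
    have := norm_image_sub_le_of_norm_deriv_le_segment' hd hb t (right_mem_Icc.2 t.2)
    simp only [Real.toNNReal_coe, Real.toNNReal_zero, T.zero_apply, zero_smul, sub_zero] at this
    rwa [sub_right_comm] at this
  have lim : ‖T t x - x - (t : ℝ) • y‖ ≤ (ε / 2 + 2 * ‖y - y‖) * t := by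
    refine le_of_tendsto_of_tendsto' (((((T t).continuous.tendsto x).comp hu).sub hu).sub
      (hv.const_smul (t : ℝ))).norm ?_ key
    exact ((((hv.sub_const y).norm).const_mul 2).const_add (ε / 2)).mul_const _
  rw [sub_self, norm_zero, mul_zero, add_zero] at lim
  have e : (t : ℝ)⁻¹ • (T t x - x) - y = (t : ℝ)⁻¹ • (T t x - x - (t : ℝ) • y) := by
    rw [smul_sub _ (T t x - x), smul_smul, inv_mul_cancel₀ ht1.ne', one_smul]
  rw [dist_eq_norm, e, norm_smul, norm_inv, Real.norm_of_nonneg ht1.le, inv_mul_lt_iff₀ ht1]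
  nlinarith

/-- Product rule for `s ↦ T_s G(t - s)`. -/
theorem hasDerivWithinAt_apply_sub {G : ℝ → X} {t s : ℝ} (hs : s ∈ Icc 0 t) {x' g' : X}
    (hG : HasDerivWithinAt G g' (Icc 0 t) (t - s)) (hx : T.IsGenerator (G (t - s)) x')
    (hg : T.IsRegular g') :
    HasDerivWithinAt (fun s : ℝ => T s.toNNReal (G (t - s))) (T s.toNNReal (x' - g'))
      (Icc 0 t) s := by
  have h1 := (hx.hasDerivWithinAt hs.1).mono (Icc_subset_Ici_self : Icc 0 t ⊆ Ici 0)
  have h2 : HasDerivWithinAt (fun r => G (t - r)) (-g') (Icc 0 t) s := by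
    have hid : HasDerivWithinAt (fun r : ℝ => t - r) (-1) (Icc 0 t) s := by
      simpa using (hasDerivWithinAt_id s (Icc 0 t)).const_sub t
    have := HasDerivWithinAt.scomp (t' := Icc 0 t) s hG hid
      (fun r hr => ⟨by linarith [hr.2], by linarith [hr.1]⟩)
    simpa [Function.comp_def] using this
  -- `r ↦ T r` need not be continuous in operator norm; the cross term is handled by continuity of
  -- the single orbit of `g'`, and the remainder in `h4` by contractivity.
  have h3 : (fun r : ℝ => T r.toNNReal g' - T s.toNNReal g') =o[𝓝[Icc 0 t] s] fun _ => (1 : ℝ) := by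
    rw [Asymptotics.isLittleO_one_iff]
    have := (hg.continuous_toNNReal.tendsto s).sub_const (T s.toNNReal g')
    rw [sub_self] at this
    exact this.mono_left nhdsWithin_le_nhds
  rw [hasDerivWithinAt_iff_isLittleO] at h1 h2 ⊢
  have h4 : (fun r : ℝ => T r.toNNReal (G (t - r) - G (t - s) - (r - s) • -g'))
      =o[𝓝[Icc 0 t] s] fun r => r - s :=
    (Asymptotics.IsBigO.of_bound 1 (Eventually.of_forall fun r => by
      rw [one_mul]; exact T.norm_apply_le _ _)).trans_isLittleO h2
  have h5 : (fun r : ℝ => (r - s) • (T r.toNNReal g' - T s.toNNReal g'))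
      =o[𝓝[Icc 0 t] s] fun r => r - s := by
    simpa using (Asymptotics.isBigO_refl (fun r : ℝ => r - s) _).smul_isLittleO h3
  refine ((h1.add h4).sub h5).congr_left fun r => ?_
  simp only [map_sub, map_smul, map_neg]
  module

end ContractionSemigroup

/-! ### The Markov semigroup as a contraction semigroup on `L^p(μ)` -/

namespace MarkovSemigroup

variable {E : Type*} [MeasurableSpace E] {P : MarkovSemigroup E} {μ : Measure E}

instance (P : MarkovSemigroup E) (t : ℝ≥0) : IsMarkovKernel (P.kernel t) := P.isMarkov t

theorem IsInvariant.comp_eq (hμ : P.IsInvariant μ) (t : ℝ≥0) : P.kernel t ∘ₘ μ = μ := hμ t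

theorem IsInvariant.ae_ae (hμ : P.IsInvariant μ) (t : ℝ≥0) {p : E → Prop} (h : ∀ᵐ y ∂μ, p y) :
    ∀ᵐ x ∂μ, ∀ᵐ y ∂(P.kernel t x), p y := by
  rw [← hμ.comp_eq t] at h
  exact Measure.ae_ae_of_ae_comp h

theorem IsInvariant.op_congr (hμ : P.IsInvariant μ) (t : ℝ≥0) {f g : E → ℝ} (h : f =ᵐ[μ] g) :
    P.op t f =ᵐ[μ] P.op t g := by
  filter_upwards [hμ.ae_ae t h] with x hx using integral_congr_ae hx

theorem IsInvariant.ae_integrable (hμ : P.IsInvariant μ) (t : ℝ≥0) {f : E → ℝ}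
    (hf : Integrable f μ) : ∀ᵐ x ∂μ, Integrable f (P.kernel t x) := by
  rw [← hμ.comp_eq t] at hf
  exact Measure.ae_integrable_of_integrable_comp hf

theorem IsInvariant.aestronglyMeasurable_op (hμ : P.IsInvariant μ) (t : ℝ≥0) {f : E → ℝ}
    (hf : AEStronglyMeasurable f μ) : AEStronglyMeasurable (P.op t f) μ :=
  ⟨_, hf.stronglyMeasurable_mk.integral_kernel (κ := P.kernel t), hμ.op_congr t hf.ae_eq_mk⟩

/-- Jensen's inequality for each `P_t(x, ·)`, in the form of monotonicity of `L^p` norms, followed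
by integration against the invariant measure. -/
theorem IsInvariant.eLpNorm_op_le (hμ : P.IsInvariant μ) (t : ℝ≥0) {p : ℝ≥0∞} (hp : 1 ≤ p)
    (hp' : p ≠ ∞) {f : E → ℝ} (hf : AEStronglyMeasurable f μ) :
    eLpNorm (P.op t f) p μ ≤ eLpNorm f p μ := by
  have hp0 : p ≠ 0 := (zero_lt_one.trans_le hp).ne'
  have hpr : 0 < p.toReal := ENNReal.toReal_pos hp0 hp'
  rw [eLpNorm_eq_lintegral_rpow_enorm_toReal hp0 hp', eLpNorm_eq_lintegral_rpow_enorm_toReal hp0 hp']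
  gcongr ?_ ^ _
  have hbind : ∫⁻ x, ‖f x‖ₑ ^ p.toReal ∂μ
      = ∫⁻ x, ∫⁻ y, ‖f y‖ₑ ^ p.toReal ∂(P.kernel t x) ∂μ := by
    conv_lhs => rw [← hμ.comp_eq t]
    refine Measure.lintegral_bind (P.kernel t).measurable.aemeasurable ?_
    rw [hμ.comp_eq t]
    exact hf.enorm.pow_const _
  rw [hbind]
  refine lintegral_mono_ae ?_
  filter_upwards [hμ.ae_ae t hf.ae_eq_mk] with x hx
  have hfx : AEStronglyMeasurable f (P.kernel t x) := ⟨_, hf.stronglyMeasurable_mk, hx⟩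
  have h1 : ‖P.op t f x‖ₑ ≤ eLpNorm f p (P.kernel t x) :=
    (enorm_integral_le_lintegral_enorm _).trans
      ((eLpNorm_one_eq_lintegral_enorm (f := f)).symm.le.trans
        (eLpNorm_le_eLpNorm_of_exponent_le hp hfx))
  rw [eLpNorm_eq_lintegral_rpow_enorm_toReal hp0 hp'] at h1
  calc _ ≤ _ := ENNReal.rpow_le_rpow h1 hpr.le
    _ = _ := by rw [← ENNReal.rpow_mul, one_div, inv_mul_cancel₀ hpr.ne', ENNReal.rpow_one]

theorem IsInvariant.memLp_op (hμ : P.IsInvariant μ) (t : ℝ≥0) {p : ℝ≥0∞} (hp : 1 ≤ p)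
    (hp' : p ≠ ∞) {f : E → ℝ} (hf : MemLp f p μ) : MemLp (P.op t f) p μ :=
  ⟨hμ.aestronglyMeasurable_op t hf.1, (hμ.eLpNorm_op_le t hp hp' hf.1).trans_lt hf.2⟩

theorem IsInvariant.op_add (hμ : P.IsInvariant μ) (t : ℝ≥0) {f g : E → ℝ}
    (hf : Integrable f μ) (hg : Integrable g μ) :
    P.op t (f + g) =ᵐ[μ] P.op t f + P.op t g := by
  filter_upwards [hμ.ae_integrable t hf, hμ.ae_integrable t hg] with x hx hx'
  exact integral_add hx hx'

theorem op_smul (t : ℝ≥0) (c : ℝ) (f : E → ℝ) : P.op t (c • f) = c • P.op t f := by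
  funext x
  exact integral_const_mul c f

theorem op_zero (f : E → ℝ) (hf : AEStronglyMeasurable f μ) : P.op 0 f =ᵐ[μ] f := by
  have h : ∀ᵐ x ∂μ, f x = hf.mk f x := hf.ae_eq_mk
  have hk : P.kernel 0 ∘ₘ μ = μ := by rw [P.zero]; exact Measure.bind_dirac
  have h2 : ∀ᵐ x ∂μ, ∀ᵐ y ∂(P.kernel 0 x), f y = hf.mk f y := by
    exact Measure.ae_ae_of_ae_comp (κ := P.kernel 0) (μ := μ) (by rwa [hk])
  filter_upwards [h, h2] with x hx hx2
  rw [op, integral_congr_ae hx2, P.zero, Kernel.id_apply,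
    integral_dirac' _ _ hf.stronglyMeasurable_mk, hx]

theorem IsInvariant.op_op (hμ : P.IsInvariant μ) (s t : ℝ≥0) {f : E → ℝ} (hf : Integrable f μ) :
    P.op (s + t) f =ᵐ[μ] P.op s (P.op t f) := by
  filter_upwards [hμ.ae_integrable (s + t) hf] with x hx
  rw [P.add] at hx
  simp only [op]
  rw [P.add, Kernel.integral_comp hx]

theorem integral_comp_kernel {ν : Measure E} (t : ℝ≥0) {f : E → ℝ}
    (hf : Integrable f (P.kernel t ∘ₘ ν)) :
    ∫ x, f x ∂(P.kernel t ∘ₘ ν) = ∫ x, P.op t f x ∂ν := by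
  rw [Measure.comp_eq_comp_const_apply] at hf ⊢
  rw [Kernel.integral_comp hf, Kernel.const_apply]
  rfl

theorem IsInvariant.integral_op (hμ : P.IsInvariant μ) (t : ℝ≥0) {f : E → ℝ}
    (hf : Integrable f μ) : ∫ x, P.op t f x ∂μ = ∫ x, f x ∂μ := by
  conv_rhs => rw [← hμ.comp_eq t]
  rw [← hμ.comp_eq t] at hf
  exact (integral_comp_kernel t hf).symm

theorem IsInvariant.op_mono (hμ : P.IsInvariant μ) (t : ℝ≥0) {f g : E → ℝ}
    (hf : Integrable f μ) (hg : Integrable g μ) (h : f ≤ᵐ[μ] g) : P.op t f ≤ᵐ[μ] P.op t g := by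
  filter_upwards [hμ.ae_integrable t hf, hμ.ae_integrable t hg, hμ.ae_ae t h] with x h1 h2 h3
  exact integral_mono_ae h1 h2 h3

variable [IsProbabilityMeasure μ]

/-- The difference of the two sides at `x` is the variance of `f` under `P_t(x, ·)`. -/
theorem IsInvariant.sq_op_le (hμ : P.IsInvariant μ) (t : ℝ≥0) {f : E → ℝ} (hf : MemLp f 2 μ) :
    P.op t f * P.op t f ≤ᵐ[μ] P.op t (f * f) := by
  filter_upwards [hμ.ae_integrable t (hf.integrable_mul hf),
    hμ.ae_integrable t (hf.integrable one_le_two)] with x h1 h2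
  have h3 : MemLp f 2 (P.kernel t x) :=
    (memLp_two_iff_integrable_sq h2.1).2 (by convert h1 using 1; funext y; exact sq (f y))
  have h4 := variance_nonneg f (P.kernel t x)
  rw [variance_eq_sub h3] at h4
  simp only [op, Pi.mul_apply] at *
  simp only [sq, Pi.mul_apply] at h4
  linarith

variable (p : ℝ≥0∞) [Fact (1 ≤ p)]

/-- The operator `P_t` on `L^p(μ)`. -/
def IsInvariant.lpOp (hμ : P.IsInvariant μ) (hp : p ≠ ∞) (t : ℝ≥0) : Lp ℝ p μ →L[ℝ] Lp ℝ p μ :=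
  LinearMap.mkContinuous
    { toFun := fun f => (hμ.memLp_op t Fact.out hp (Lp.memLp f)).toLp
      map_add' := fun f g => by
        rw [← MemLp.toLp_add]
        refine MemLp.toLp_congr _ _ ((hμ.op_congr t (Lp.coeFn_add f g)).trans ?_)
        exact hμ.op_add t ((Lp.memLp f).integrable Fact.out) ((Lp.memLp g).integrable Fact.out)
      map_smul' := fun c f => by
        rw [RingHom.id_apply, ← MemLp.toLp_const_smul]
        refine MemLp.toLp_congr _ _ ((hμ.op_congr t (Lp.coeFn_smul c f)).trans ?_)
        rw [op_smul] } 1 fun f => by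
      rw [one_mul]
      change ‖(hμ.memLp_op t Fact.out hp (Lp.memLp f)).toLp‖ ≤ ‖f‖
      rw [Lp.norm_toLp, Lp.norm_def]
      exact ENNReal.toReal_mono (Lp.eLpNorm_ne_top f)
        (hμ.eLpNorm_op_le t Fact.out hp (Lp.aestronglyMeasurable f))

variable {p} (hμ : P.IsInvariant μ) (hp : p ≠ ∞)

theorem IsInvariant.lpOp_apply (t : ℝ≥0) (f : Lp ℝ p μ) :
    hμ.lpOp p hp t f = (hμ.memLp_op t Fact.out hp (Lp.memLp f)).toLp := rfl

theorem IsInvariant.coeFn_lpOp (t : ℝ≥0) (f : Lp ℝ p μ) :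
    hμ.lpOp p hp t f =ᵐ[μ] P.op t f := by
  rw [lpOp_apply]
  exact MemLp.coeFn_toLp _

variable (p) in
/-- The semigroup `(P_t)` acting on `L^p(μ)`. -/
def IsInvariant.lpSemigroup : ContractionSemigroup (Lp ℝ p μ) where
  toFun := hμ.lpOp p hp
  zero_apply f := Lp.ext ((hμ.coeFn_lpOp hp 0 f).trans (op_zero _ (Lp.aestronglyMeasurable f)))
  add_apply s t f := by
    refine Lp.ext ((hμ.coeFn_lpOp hp _ f).trans ?_)
    refine (hμ.op_op s t ((Lp.memLp f).integrable Fact.out)).trans ?_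
    exact (hμ.op_congr s (hμ.coeFn_lpOp hp t f).symm).trans (hμ.coeFn_lpOp hp s _).symm
  norm_apply_le t f := by
    refine (ContinuousLinearMap.le_of_opNorm_le _ ?_ f).trans_eq (one_mul _)
    exact LinearMap.mkContinuous_norm_le _ zero_le_one _

theorem IsInvariant.coeFn_lpSemigroup (t : ℝ≥0) (f : Lp ℝ p μ) :
    hμ.lpSemigroup p hp t f =ᵐ[μ] P.op t f :=
  hμ.coeFn_lpOp hp t f

theorem IsInvariant.lpSemigroup_toLp (t : ℝ≥0) {f : E → ℝ} (hf : MemLp f p μ) :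
    hμ.lpSemigroup p hp t hf.toLp = (hμ.memLp_op t Fact.out hp hf).toLp :=
  Lp.ext ((hμ.coeFn_lpOp hp t _).trans ((hμ.op_congr t hf.coeFn_toLp).trans
    (MemLp.coeFn_toLp _).symm))

theorem IsInvariant.isGenerator_toLp_iff {f g : E → ℝ} (hf : MemLp f p μ) (hg : MemLp g p μ) :
    (hμ.lpSemigroup p hp).IsGenerator hf.toLp hg.toLp ↔ P.IsGen μ p f g := by
  rw [ContractionSemigroup.IsGenerator, IsGen, tendsto_iff_edist_tendsto_0]
  simp only [hf, hg, true_and]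
  refine tendsto_congr fun t => ?_
  rw [hμ.lpSemigroup_toLp hp, ← MemLp.toLp_sub, ← MemLp.toLp_const_smul, Lp.edist_toLp_toLp]
  rfl

end MarkovSemigroup

/-! ### The semigroup on the graph of its generator -/

namespace ContractionSemigroup

variable {X : Type*} [NormedAddCommGroup X] [NormedSpace ℝ X] (T : ContractionSemigroup X)

/-- The graph of the generator. -/
def graph : Submodule ℝ (X × X) where
  carrier := {U | T.IsGenerator U.1 U.2}
  add_mem' h h' := IsGenerator.add h h'
  zero_mem' := isGenerator_zero
  smul_mem' c _ h := IsGenerator.smul c h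

variable {T}

theorem mem_graph {U : X × X} : U ∈ T.graph ↔ T.IsGenerator U.1 U.2 := Iff.rfl

variable (T) in
/-- The operator `T t` acting on the graph of the generator. -/
def graphOp (t : ℝ≥0) : T.graph →L[ℝ] T.graph :=
  ((T t).prodMap (T t)).restrict fun _ hU => IsGenerator.apply hU t

variable (T) in
/-- The semigroup acting on the graph of its generator. -/
def graphSemigroup : ContractionSemigroup T.graph where
  toFun := T.graphOp
  zero_apply _ := Subtype.ext (Prod.ext (T.zero_apply _) (T.zero_apply _))
  add_apply s t _ := Subtype.ext (Prod.ext (T.add_apply s t _) (T.add_apply s t _))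
  norm_apply_le t _ := max_le_max (T.norm_apply_le t _) (T.norm_apply_le t _)

theorem coe_graphSemigroup (t : ℝ≥0) (U : T.graph) :
    (T.graphSemigroup t U : X × X) = (T t U.1.1, T t U.1.2) := rfl

/-- If `Lf` is again in the domain, the orbit of `(f, Lf)` is differentiable in graph norm; this
makes `u ↦ Γ(P_u f)` differentiable. -/
theorem isGenerator_graphSemigroup {U V : T.graph} (h : U.1.2 = V.1.1) :
    T.graphSemigroup.IsGenerator U V := by
  rw [IsGenerator, tendsto_subtype_rng]
  have h2 : T.IsGenerator U.1.2 V.1.2 := h ▸ V.2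
  have h1 : T.IsGenerator U.1.1 V.1.1 := h ▸ U.2
  exact h1.prodMk_nhds h2

end ContractionSemigroup

/-! ### The carré du champ as a bounded bilinear map with values in `L¹` -/

namespace MarkovSemigroup

open ContractionSemigroup

variable {E : Type*} [MeasurableSpace E] {P : MarkovSemigroup E} {μ : Measure E}

/-- Multiplication `L² × L² → L¹`. -/
def mulL (μ : Measure E) : Lp ℝ 2 μ →L[ℝ] Lp ℝ 2 μ →L[ℝ] Lp ℝ 1 μ :=
  (ContinuousLinearMap.mul ℝ ℝ).holderL μ 2 2 1

theorem coeFn_mulL (u v : Lp ℝ 2 μ) : mulL μ u v =ᵐ[μ] u * v :=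
  ContinuousLinearMap.coeFn_holder (r := 1) (ContinuousLinearMap.mul ℝ ℝ) u v

theorem mulL_comm (u v : Lp ℝ 2 μ) : mulL μ u v = mulL μ v u :=
  Lp.ext ((coeFn_mulL u v).trans ((mul_comm (u : E → ℝ) v) ▸ (coeFn_mulL v u).symm))

theorem norm_mulL_le (u v : Lp ℝ 2 μ) : ‖mulL μ u v‖ ≤ ‖u‖ * ‖v‖ := by
  refine (ContinuousLinearMap.norm_holder_apply_apply_le (r := 1)
    (ContinuousLinearMap.mul ℝ ℝ) u v).trans ?_
  gcongr
  exact mul_le_of_le_one_left (norm_nonneg _) (ContinuousLinearMap.opNorm_mul_le ℝ ℝ)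

theorem tendsto_bilinear_apply {X Y Z : Type*} [NormedAddCommGroup X] [NormedSpace ℝ X]
    [NormedAddCommGroup Y] [NormedSpace ℝ Y] [NormedAddCommGroup Z] [NormedSpace ℝ Z]
    (B : X →L[ℝ] Y →L[ℝ] Z) {ι : Type*} {l : Filter ι} {f : ι → X} {g : ι → Y} {u : X} {v : Y}
    (hf : Tendsto f l (𝓝 u)) (hg : Tendsto g l (𝓝 v)) :
    Tendsto (fun i => B (f i) (g i)) l (𝓝 (B u v)) :=
  (B.continuous₂.tendsto (u, v)).comp (hf.prodMk_nhds hg)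

/-- The integral over a set, as a continuous linear form on `L¹`. -/
def setIntegralL (μ : Measure E) (s : Set E) : Lp ℝ 1 μ →L[ℝ] ℝ where
  toFun f := ∫ x in s, f x ∂μ
  map_add' f g := by
    rw [← integral_add (L1.integrable_coeFn f).integrableOn (L1.integrable_coeFn g).integrableOn]
    exact integral_congr_ae (ae_restrict_of_ae (Lp.coeFn_add f g))
  map_smul' c f := by
    rw [RingHom.id_apply, ← integral_smul]
    exact integral_congr_ae (ae_restrict_of_ae (Lp.coeFn_smul c f))
  cont := continuous_setIntegral s

theorem setIntegralL_apply (s : Set E) (f : Lp ℝ 1 μ) :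
    setIntegralL μ s f = ∫ x in s, f x ∂μ := rfl

theorem setIntegralL_nonneg (s : Set E) {f : Lp ℝ 1 μ} (hf : 0 ≤ f) : 0 ≤ setIntegralL μ s f :=
  integral_nonneg_of_ae (ae_restrict_of_ae ((Lp.coeFn_nonneg f).2 hf))

theorem lp_smul_nonneg {c : ℝ} (hc : 0 ≤ c) {f : Lp ℝ 1 μ} (hf : 0 ≤ f) : 0 ≤ c • f := by
  rw [← Lp.coeFn_nonneg] at hf ⊢
  filter_upwards [hf, Lp.coeFn_smul c f] with x h1 h2
  rw [h2]
  exact mul_nonneg hc h1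

theorem le_of_forall_setIntegralL_le [IsFiniteMeasure μ] {f g : Lp ℝ 1 μ}
    (h : ∀ s, MeasurableSet s → setIntegralL μ s f ≤ setIntegralL μ s g) : f ≤ g :=
  (Lp.coeFn_le f g).1 (ae_le_of_forall_setIntegral_le (L1.integrable_coeFn f)
    (L1.integrable_coeFn g) fun s hs _ => h s hs)

theorem norm_eq_setIntegralL_univ {f : Lp ℝ 1 μ} (hf : 0 ≤ f) : ‖f‖ = setIntegralL μ univ f := by
  rw [L1.norm_eq_integral_norm, setIntegralL_apply, Measure.restrict_univ]
  refine integral_congr_ae ?_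
  filter_upwards [(Lp.coeFn_nonneg f).2 hf] with x hx
  exact Real.norm_of_nonneg hx

/-- A curve in `L¹` with nonnegative derivative is increasing. -/
theorem le_of_hasDerivWithinAt_nonneg [IsFiniteMeasure μ] {φ φ' : ℝ → Lp ℝ 1 μ} {t : ℝ} (ht : 0 ≤ t)
    (h : ∀ s ∈ Icc 0 t, HasDerivWithinAt φ (φ' s) (Icc 0 t) s) (h0 : ∀ s ∈ Icc 0 t, 0 ≤ φ' s) :
    φ 0 ≤ φ t := by
  -- Order in `L¹` is tested by integrals over measurable sets, which reduces the claim to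
  -- real-valued functions.
  refine le_of_forall_setIntegralL_le fun A _ => ?_
  have hd : ∀ s ∈ Icc 0 t, HasDerivWithinAt (fun s => setIntegralL μ A (φ s))
      (setIntegralL μ A (φ' s)) (Icc 0 t) s := fun s hs =>
    (setIntegralL μ A).hasFDerivAt.comp_hasDerivWithinAt s (h s hs)
  have hmono : MonotoneOn (fun s => setIntegralL μ A (φ s)) (Icc 0 t) := by
    refine monotoneOn_of_deriv_nonneg (convex_Icc 0 t)
      (fun s hs => (hd s hs).continuousWithinAt) (fun s hs => ?_) fun s hs => ?_
    · exact ((hd s (interior_subset hs)).mono interior_subset).differentiableWithinAt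
    · rw [((hd s (interior_subset hs)).hasDerivAt (mem_interior_iff_mem_nhds.1 hs)).deriv]
      exact setIntegralL_nonneg A (h0 s (interior_subset hs))
  exact hmono (left_mem_Icc.2 ht) (right_mem_Icc.2 ht) ht

variable [IsProbabilityMeasure μ] (hμ : P.IsInvariant μ)

/-- The semigroup acting on `L¹`. -/
abbrev IsInvariant.onL1 : ContractionSemigroup (Lp ℝ 1 μ) := hμ.lpSemigroup 1 ENNReal.one_ne_top

/-- The semigroup acting on `L²`. -/
abbrev IsInvariant.onL2 : ContractionSemigroup (Lp ℝ 2 μ) := hμ.lpSemigroup 2 ENNReal.ofNat_ne_top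

theorem IsInvariant.onL1_mono (t : ℝ≥0) {f g : Lp ℝ 1 μ} (h : f ≤ g) :
    hμ.onL1 t f ≤ hμ.onL1 t g := by
  rw [← Lp.coeFn_le] at h ⊢
  filter_upwards [hμ.coeFn_lpSemigroup ENNReal.one_ne_top t f,
    hμ.coeFn_lpSemigroup ENNReal.one_ne_top t g,
    hμ.op_mono t (L1.integrable_coeFn f) (L1.integrable_coeFn g) h] with x h1 h2 h3
  rwa [h1, h2]

theorem IsInvariant.mulL_onL2_le (t : ℝ≥0) (u : Lp ℝ 2 μ) :
    mulL μ (hμ.onL2 t u) (hμ.onL2 t u) ≤ hμ.onL1 t (mulL μ u u) := by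
  rw [← Lp.coeFn_le]
  filter_upwards [coeFn_mulL (hμ.onL2 t u) (hμ.onL2 t u),
    hμ.coeFn_lpSemigroup ENNReal.ofNat_ne_top t u,
    hμ.coeFn_lpSemigroup ENNReal.one_ne_top t (mulL μ u u), hμ.op_congr t (coeFn_mulL u u),
    hμ.sq_op_le t (Lp.memLp u)] with x h1 h2 h3 h4 h5
  rw [h1, h3, h4, Pi.mul_apply, h2]
  exact h5

theorem IsInvariant.setIntegralL_univ_onL1 (t : ℝ≥0) (f : Lp ℝ 1 μ) :
    setIntegralL μ univ (hμ.onL1 t f) = setIntegralL μ univ f := by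
  rw [setIntegralL_apply, setIntegralL_apply, Measure.restrict_univ,
    integral_congr_ae (hμ.coeFn_lpSemigroup ENNReal.one_ne_top t f),
    hμ.integral_op t (L1.integrable_coeFn f)]

/-- By invariance, difference quotients have integral zero. -/
theorem IsInvariant.setIntegralL_univ_generator {f g : Lp ℝ 1 μ} (h : hμ.onL1.IsGenerator f g) :
    setIntegralL μ univ g = 0 := by
  refine tendsto_nhds_unique (((setIntegralL μ univ).continuous.tendsto g).comp h) ?_
  refine tendsto_const_nhds.congr fun t => ?_
  simp [hμ.setIntegralL_univ_onL1]

variable {hμ}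

/-- `Γ(u)` is the `L¹` limit of `t⁻¹ (P_t(u²) - (P_t u)²)`, which is nonnegative. -/
theorem carre_self_nonneg {u u' : Lp ℝ 2 μ} {k : Lp ℝ 1 μ} (hu : hμ.onL2.IsGenerator u u')
    (hk : hμ.onL1.IsGenerator (mulL μ u u) k) : 0 ≤ k - mulL μ u u' - mulL μ u u' := by
  have hcont : Tendsto (fun t => hμ.onL2 t u) (𝓝[>] 0) (𝓝 u) :=
    Tendsto.mono_left hu.isRegular_left nhdsWithin_le_nhds
  have h1 : Tendsto (fun t : ℝ≥0 => mulL μ (hμ.onL2 t u) ((t : ℝ)⁻¹ • (hμ.onL2 t u - u)))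
      (𝓝[>] 0) (𝓝 (mulL μ u u')) :=
    tendsto_bilinear_apply (mulL μ) hcont hu
  have h2 : Tendsto (fun t : ℝ≥0 => mulL μ u ((t : ℝ)⁻¹ • (hμ.onL2 t u - u)))
      (𝓝[>] 0) (𝓝 (mulL μ u u')) := ((mulL μ u).continuous.tendsto u').comp hu
  have h3 : Tendsto (fun t : ℝ≥0 => (t : ℝ)⁻¹ • (hμ.onL1 t (mulL μ u u) - mulL μ u u))
      (𝓝[>] 0) (𝓝 k) := hk
  refine ge_of_tendsto' ((h3.sub h1).sub h2) fun t => ?_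
  have e : (t : ℝ)⁻¹ • (hμ.onL1 t (mulL μ u u) - mulL μ u u)
      - mulL μ (hμ.onL2 t u) ((t : ℝ)⁻¹ • (hμ.onL2 t u - u))
      - mulL μ u ((t : ℝ)⁻¹ • (hμ.onL2 t u - u))
      = (t : ℝ)⁻¹ • (hμ.onL1 t (mulL μ u u) - mulL μ (hμ.onL2 t u) (hμ.onL2 t u)) := by
    simp only [map_smul, map_sub, mulL_comm u (hμ.onL2 t u)]
    module
  rw [e]
  exact lp_smul_nonneg (by positivity) (sub_nonneg.2 (hμ.mulL_onL2_le t u))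

/-- From `Γ(u ± v) ≥ 0` one gets `|2 Γ(u, v)| ≤ Γ(u) + Γ(v)`, and `∫ Γ(u) dμ = -2 ∫ u Lu dμ` is at
most twice the squared graph norm. -/
theorem norm_carre_le_add {U V : Lp ℝ 2 μ × Lp ℝ 2 μ} {k l m : Lp ℝ 1 μ} (hU : U ∈ hμ.onL2.graph)
    (hV : V ∈ hμ.onL2.graph) (hk : hμ.onL1.IsGenerator (mulL μ U.1 U.1) k)
    (hl : hμ.onL1.IsGenerator (mulL μ V.1 V.1) l) (hm : hμ.onL1.IsGenerator (mulL μ U.1 V.1) m) :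
    ‖m - mulL μ U.1 V.2 - mulL μ V.1 U.2‖ ≤ ‖U‖ ^ 2 + ‖V‖ ^ 2 := by
  obtain ⟨u, u'⟩ := U
  obtain ⟨v, v'⟩ := V
  rw [mem_graph] at hU hV
  dsimp only at *
  have hadd := carre_self_nonneg (hμ := hμ) (k := k + 2 • m + l) (hU.add hV) <| by
    convert! (hk.add (hm.smul 2)).add hl using 1
    · simp only [map_add, _root_.add_apply, mulL_comm v u]; module
    · module
  have hsub := carre_self_nonneg (hμ := hμ) (k := k - 2 • m + l) (hU.sub hV) <| by
    convert! (hk.sub (hm.smul 2)).add hl using 1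
    · simp only [map_sub, sub_apply, mulL_comm v u]; module
    · module
  set a := k - mulL μ u u' - mulL μ u u' with ha
  set b := l - mulL μ v v' - mulL μ v v' with hb
  set c := m - mulL μ u v' - mulL μ v u' with hc
  have h1 : (2 : ℝ) • c ≤ a + b := by
    rw [← sub_nonneg]; convert hsub using 1
    simp only [ha, hb, hc, map_sub, sub_apply]; module
  have h2 : -((2 : ℝ) • c) ≤ a + b := by
    rw [← sub_nonneg]; convert hadd using 1
    simp only [ha, hb, hc, map_add, _root_.add_apply]; module
  have hab : 0 ≤ a + b := add_nonneg (carre_self_nonneg hU hk) (carre_self_nonneg hV hl)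
  have h3 : ‖(2 : ℝ) • c‖ ≤ ‖a + b‖ := by
    refine norm_le_norm_of_abs_le_abs ?_
    rw [abs_of_nonneg hab]
    exact abs_le'.2 ⟨h1, h2⟩
  have h4 : ‖a + b‖ = -2 * (setIntegralL μ univ (mulL μ u u') + setIntegralL μ univ (mulL μ v v')) := by
    rw [norm_eq_setIntegralL_univ hab]
    simp only [ha, hb, map_add, map_sub, hμ.setIntegralL_univ_generator hk,
      hμ.setIntegralL_univ_generator hl]
    ring
  have h5 : ∀ w w' : Lp ℝ 2 μ, -setIntegralL μ univ (mulL μ w w') ≤ ‖(w, w')‖ ^ 2 := by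
    intro w w'
    calc -setIntegralL μ univ (mulL μ w w') ≤ ‖mulL μ w w'‖ := by
          rw [setIntegralL_apply, Measure.restrict_univ, L1.norm_eq_integral_norm]
          exact (neg_le_abs _).trans (norm_integral_le_integral_norm (mulL μ w w' : E → ℝ))
      _ ≤ ‖w‖ * ‖w'‖ := norm_mulL_le w w'
      _ ≤ ‖(w, w')‖ * ‖(w, w')‖ := by
        gcongr
        · exact le_max_left _ _
        · exact le_max_right _ _
      _ = _ := (sq _).symm
  rw [norm_smul, Real.norm_two, h4] at h3
  linarith [h5 u u', h5 v v']

/-- The previous bound applied to vectors normalized in graph norm. -/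
theorem norm_carre_le {U V : Lp ℝ 2 μ × Lp ℝ 2 μ} {k l m : Lp ℝ 1 μ} (hU : U ∈ hμ.onL2.graph)
    (hV : V ∈ hμ.onL2.graph) (hk : hμ.onL1.IsGenerator (mulL μ U.1 U.1) k)
    (hl : hμ.onL1.IsGenerator (mulL μ V.1 V.1) l) (hm : hμ.onL1.IsGenerator (mulL μ U.1 V.1) m) :
    ‖m - mulL μ U.1 V.2 - mulL μ V.1 U.2‖ ≤ 2 * ‖U‖ * ‖V‖ := by
  rcases eq_or_ne U 0 with rfl | hU0
  · have : m = 0 := hm.unique (by simpa using isGenerator_zero)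
    simp [this]
  rcases eq_or_ne V 0 with rfl | hV0
  · have : m = 0 := hm.unique (by simpa using isGenerator_zero)
    simp [this]
  have ha : 0 < ‖U‖ := norm_pos_iff.2 hU0
  have hb : 0 < ‖V‖ := norm_pos_iff.2 hV0
  have key := norm_carre_le_add (hμ := hμ) (U := ‖U‖⁻¹ • U) (V := ‖V‖⁻¹ • V)
    (Submodule.smul_mem _ _ hU) (Submodule.smul_mem _ _ hV)
    (k := (‖U‖⁻¹ * ‖U‖⁻¹) • k) (l := (‖V‖⁻¹ * ‖V‖⁻¹) • l) (m := (‖U‖⁻¹ * ‖V‖⁻¹) • m)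
    (by simpa [smul_smul] using hk.smul (‖U‖⁻¹ * ‖U‖⁻¹))
    (by simpa [smul_smul] using hl.smul (‖V‖⁻¹ * ‖V‖⁻¹))
    (by simpa [smul_smul, mul_comm] using hm.smul (‖U‖⁻¹ * ‖V‖⁻¹))
  have e : (‖U‖⁻¹ * ‖V‖⁻¹) • m - mulL μ (‖U‖⁻¹ • U).1 (‖V‖⁻¹ • V).2
      - mulL μ (‖V‖⁻¹ • V).1 (‖U‖⁻¹ • U).2
      = (‖U‖⁻¹ * ‖V‖⁻¹) • (m - mulL μ U.1 V.2 - mulL μ V.1 U.2) := by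
    simp only [Prod.smul_fst, Prod.smul_snd, map_smul, smul_apply]
    module
  rw [e, norm_smul, norm_smul, norm_smul, norm_mul] at key
  simp only [norm_inv, norm_norm, inv_mul_cancel₀ ha.ne', inv_mul_cancel₀ hb.ne'] at key
  rw [← mul_inv, inv_mul_le_iff₀ (by positivity)] at key
  linarith

/-- Squares stay in the domain of the `L¹` generator under graph limits. -/
theorem exists_isGenerator_sq_of_mem_closure {S : Set (Lp ℝ 2 μ × Lp ℝ 2 μ)}
    (hS : S ⊆ hμ.onL2.graph)
    (hmul : ∀ U ∈ S, ∀ V ∈ S, ∃ k, hμ.onL1.IsGenerator (mulL μ U.1 V.1) k)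
    {U : Lp ℝ 2 μ × Lp ℝ 2 μ} (hU : U ∈ closure S) :
    ∃ k, hμ.onL1.IsGenerator (mulL μ U.1 U.1) k := by
  obtain ⟨W, hW, hlim⟩ := mem_closure_iff_seq_limit.1 hU
  choose K hK using fun n => hmul (W n) (hW n) (W n) (hW n)
  -- `W n² - W m² = (W n - W m)(W n + W m)`, so `K n - K m` is `Γ` of the difference and the sum
  -- plus two product terms, each controlled by graph norms. Hence `K` is Cauchy, and closedness of
  -- the `L¹` generator concludes.
  have hest : ∀ n m, dist (K n) (K m) ≤ 4 * ‖W n - W m‖ * ‖W n + W m‖ := by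
    intro n m
    obtain ⟨c, hc⟩ := hmul (W n) (hW n) (W m) (hW m)
    have hgsub := Submodule.sub_mem _ (hS (hW n)) (hS (hW m))
    have hgadd := Submodule.add_mem _ (hS (hW n)) (hS (hW m))
    have hbound := norm_carre_le (hμ := hμ) (k := K n - (2 : ℝ) • c + K m)
      (l := K n + (2 : ℝ) • c + K m) (m := K n - K m) hgsub hgadd
      (by
        convert ((hK n).sub (hc.smul 2)).add (hK m) using 1
        simp only [Prod.fst_sub, map_sub, sub_apply,
          mulL_comm (W m).1 (W n).1]
        module)
      (by
        convert ((hK n).add (hc.smul 2)).add (hK m) using 1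
        simp only [Prod.fst_add, map_add, _root_.add_apply,
          mulL_comm (W m).1 (W n).1]
        module)
      (by
        convert (hK n).sub (hK m) using 1
        simp only [Prod.fst_add, Prod.fst_sub, map_sub, map_add, sub_apply,
          mulL_comm (W m).1 (W n).1]
        module)
    have h1 := norm_mulL_le (W n - W m).1 (W n + W m).2
    have h2 := norm_mulL_le (W n + W m).1 (W n - W m).2
    have h3 : ‖(W n - W m).1‖ * ‖(W n + W m).2‖ ≤ ‖W n - W m‖ * ‖W n + W m‖ :=
      mul_le_mul (norm_fst_le _) (norm_snd_le _) (norm_nonneg _) (norm_nonneg _)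
    have h4 : ‖(W n + W m).1‖ * ‖(W n - W m).2‖ ≤ ‖W n + W m‖ * ‖W n - W m‖ :=
      mul_le_mul (norm_fst_le _) (norm_snd_le _) (norm_nonneg _) (norm_nonneg _)
    rw [dist_eq_norm]
    have h5 := norm_add₃_le (a := K n - K m - mulL μ (W n - W m).1 (W n + W m).2
      - mulL μ (W n + W m).1 (W n - W m).2) (b := mulL μ (W n - W m).1 (W n + W m).2)
      (c := mulL μ (W n + W m).1 (W n - W m).2)
    rw [sub_right_comm, sub_add_cancel, sub_add_cancel] at h5
    rw [sub_right_comm] at hbound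
    nlinarith
  have hcauchy : CauchySeq K := by
    rw [cauchySeq_iff_tendsto_dist_atTop_0]
    refine squeeze_zero (fun _ => dist_nonneg) (fun n => hest n.1 n.2) ?_
    rw [← prod_atTop_atTop_eq]
    have h1 := hlim.comp (tendsto_fst (f := atTop (α := ℕ)) (g := atTop (α := ℕ)))
    have h2 := hlim.comp (tendsto_snd (f := atTop (α := ℕ)) (g := atTop (α := ℕ)))
    have := ((h1.sub h2).norm.const_mul 4).mul (h1.add h2).norm
    simpa using this
  obtain ⟨k, hk⟩ := cauchySeq_tendsto_of_complete hcauchy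
  refine ⟨k, isGenerator_of_tendsto hK ?_ hk⟩
  have h1 : Tendsto (fun n => (W n).1) atTop (𝓝 U.1) := (continuous_fst.tendsto U).comp hlim
  exact tendsto_bilinear_apply (mulL μ) h1 h1

/-- Polarization. -/
theorem exists_isGenerator_mul
    (hsq : ∀ U ∈ hμ.onL2.graph, ∃ k, hμ.onL1.IsGenerator (mulL μ U.1 U.1) k)
    (U V : hμ.onL2.graph) : ∃ k, hμ.onL1.IsGenerator (mulL μ U.1.1 V.1.1) k := by
  obtain ⟨k, hk⟩ := hsq U U.2
  obtain ⟨l, hl⟩ := hsq V V.2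
  obtain ⟨m, hm⟩ := hsq (U + V) (U + V).2
  refine ⟨(1 / 2 : ℝ) • (m - k - l), ?_⟩
  convert ((hm.sub hk).sub hl).smul (1 / 2) using 1
  simp only [Prod.fst_add, map_add, _root_.add_apply,
    mulL_comm V.1.1 U.1.1]
  module

/-- The "carré du champ" as a continuous bilinear map on the graph of the `L²` generator. -/
def carreL (hmul : ∀ U V : hμ.onL2.graph, ∃ k, hμ.onL1.IsGenerator (mulL μ U.1.1 V.1.1) k) :
    hμ.onL2.graph →L[ℝ] hμ.onL2.graph →L[ℝ] Lp ℝ 1 μ :=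
  LinearMap.mkContinuous₂
    (LinearMap.mk₂ ℝ
      (fun U V => (hmul U V).choose - mulL μ U.1.1 V.1.2 - mulL μ V.1.1 U.1.2)
      (fun U U' V => by
        have h : (hmul (U + U') V).choose = (hmul U V).choose + (hmul U' V).choose :=
          (hmul (U + U') V).choose_spec.unique <| by
            simpa using (hmul U V).choose_spec.add (hmul U' V).choose_spec
        rw [h]
        simp only [Submodule.coe_add, Prod.fst_add, Prod.snd_add, map_add,
          _root_.add_apply]
        abel)
      (fun c U V => by
        have h : (hmul (c • U) V).choose = c • (hmul U V).choose :=
          (hmul (c • U) V).choose_spec.unique <| by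
            simpa using (hmul U V).choose_spec.smul c
        rw [h]
        simp only [Submodule.coe_smul, Prod.smul_fst, Prod.smul_snd, map_smul,
          smul_apply]
        module)
      (fun U V V' => by
        have h : (hmul U (V + V')).choose = (hmul U V).choose + (hmul U V').choose :=
          (hmul U (V + V')).choose_spec.unique <| by
            simpa using (hmul U V).choose_spec.add (hmul U V').choose_spec
        rw [h]
        simp only [Submodule.coe_add, Prod.fst_add, Prod.snd_add, map_add,
          _root_.add_apply]
        abel)
      (fun c U V => by
        have h : (hmul U (c • V)).choose = c • (hmul U V).choose :=
          (hmul U (c • V)).choose_spec.unique <| by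
            simpa using (hmul U V).choose_spec.smul c
        rw [h]
        simp only [Submodule.coe_smul, Prod.smul_fst, Prod.smul_snd, map_smul,
          smul_apply]
        module)) 2
    fun U V => norm_carre_le U.2 V.2 (hmul U U).choose_spec (hmul V V).choose_spec
      (hmul U V).choose_spec

variable {hmul : ∀ U V : hμ.onL2.graph, ∃ k, hμ.onL1.IsGenerator (mulL μ U.1.1 V.1.1) k}

theorem carreL_eq {U V : hμ.onL2.graph} {k : Lp ℝ 1 μ}
    (hk : hμ.onL1.IsGenerator (mulL μ U.1.1 V.1.1) k) :
    carreL hmul U V = k - mulL μ U.1.1 V.1.2 - mulL μ V.1.1 U.1.2 := by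
  rw [hk.unique (hmul U V).choose_spec]
  rfl

theorem carreL_comm (U V : hμ.onL2.graph) : carreL hmul U V = carreL hmul V U := by
  obtain ⟨k, hk⟩ := hmul U V
  rw [carreL_eq hk, carreL_eq (mulL_comm U.1.1 V.1.1 ▸ hk), sub_right_comm]

theorem carreL_self_nonneg (U : hμ.onL2.graph) : 0 ≤ carreL hmul U U := by
  obtain ⟨k, hk⟩ := hmul U U
  rw [carreL_eq hk]
  exact carre_self_nonneg U.2 hk

/-- `L(u²) = Γ(u) + 2 u Lu`: in the local Poincaré inequality the last term cancels against the
derivative of the square, leaving `Γ`. -/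
theorem isGenerator_mulL (U : hμ.onL2.graph) : hμ.onL1.IsGenerator (mulL μ U.1.1 U.1.1)
    (carreL hmul U U + (2 : ℝ) • mulL μ U.1.1 U.1.2) := by
  obtain ⟨k, hk⟩ := hmul U U
  rw [carreL_eq hk]
  convert hk using 1
  module

end MarkovSemigroup

/-! ### Curvature: gradient bound and local Poincaré inequality -/

namespace MarkovSemigroup

open ContractionSemigroup

variable {E : Type*} [MeasurableSpace E] {P : MarkovSemigroup E} {μ : Measure E}
  [IsProbabilityMeasure μ]

theorem IsInvariant.isGen_one_of_two (hμ : P.IsInvariant μ) {f g : E → ℝ} (h : P.IsGen μ 2 f g) :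
    P.IsGen μ 1 f g := by
  refine ⟨h.1.mono_exponent one_le_two, h.2.1.mono_exponent one_le_two, ?_⟩
  refine tendsto_of_tendsto_of_tendsto_of_le_of_le tendsto_const_nhds h.2.2
    (fun _ => zero_le) fun t => ?_
  refine eLpNorm_le_eLpNorm_of_exponent_le one_le_two ?_
  exact (((hμ.aestronglyMeasurable_op t h.1.1).sub h.1.1).const_mul _).sub h.2.1.1

variable {hμ : P.IsInvariant μ}

/-- The choice made in `gen` is harmless, since limits in `L¹` are unique. -/
theorem gen_ae_eq_of_isGenerator {f : E → ℝ} {F k : Lp ℝ 1 μ} (hf : f =ᵐ[μ] F)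
    (hk : hμ.onL1.IsGenerator F k) : P.gen μ f =ᵐ[μ] k := by
  have hfm : MemLp f 1 μ := (memLp_congr_ae hf).2 (Lp.memLp F)
  have hF : hfm.toLp = F := Lp.ext (hfm.coeFn_toLp.trans hf)
  have hgen : P.IsGen μ 1 f k := by
    rw [← hμ.isGenerator_toLp_iff ENNReal.one_ne_top hfm (Lp.memLp k), hF, Lp.toLp_coeFn]
    exact hk
  have hex : ∃ g, P.IsGen μ 1 f g := ⟨k, hgen⟩
  rw [gen, dif_pos hex]
  have hs := hex.choose_spec
  have h1 := (hμ.isGenerator_toLp_iff ENNReal.one_ne_top hs.1 hs.2.1).2 hs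
  have h2 : hs.2.1.toLp = k := h1.unique (hF ▸ hk)
  exact hs.2.1.coeFn_toLp.symm.trans (h2 ▸ Filter.EventuallyEq.rfl)

theorem exists_graph_of_mem_dom {f : E → ℝ} (hf : f ∈ P.dom μ 2) :
    ∃ U : hμ.onL2.graph, (U.1.1 : E → ℝ) =ᵐ[μ] f := by
  obtain ⟨g, hg⟩ := hf
  exact ⟨⟨(hg.1.toLp, hg.2.1.toLp),
    (hμ.isGenerator_toLp_iff ENNReal.ofNat_ne_top hg.1 hg.2.1).2 hg⟩, hg.1.coeFn_toLp⟩

theorem isGen_of_graph {U : hμ.onL2.graph} {f : E → ℝ} (hf : (U.1.1 : E → ℝ) =ᵐ[μ] f) :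
    P.IsGen μ 2 f U.1.2 := by
  have hfm : MemLp f 2 μ := (memLp_congr_ae hf).1 (Lp.memLp _)
  have hF : hfm.toLp = U.1.1 := Lp.ext (hfm.coeFn_toLp.trans hf.symm)
  rw [← hμ.isGenerator_toLp_iff ENNReal.ofNat_ne_top hfm (Lp.memLp U.1.2), hF, Lp.toLp_coeFn]
  exact U.2

theorem gen_ae_eq_of_graph {U : hμ.onL2.graph} {f : E → ℝ} (hf : (U.1.1 : E → ℝ) =ᵐ[μ] f) :
    P.gen μ f =ᵐ[μ] U.1.2 := by
  have h := hμ.isGen_one_of_two (isGen_of_graph hf)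
  exact (gen_ae_eq_of_isGenerator h.1.coeFn_toLp.symm
    ((hμ.isGenerator_toLp_iff ENNReal.one_ne_top h.1 h.2.1).2 h)).trans h.2.1.coeFn_toLp

theorem IsCore.mem_closure {S : Set (E → ℝ)} (hS : P.IsCore μ S) (U : hμ.onL2.graph) :
    (U : Lp ℝ 2 μ × Lp ℝ 2 μ) ∈
      closure {V | V ∈ hμ.onL2.graph ∧ ∃ g ∈ S, (V.1 : E → ℝ) =ᵐ[μ] g} := by
  rw [EMetric.mem_closure_iff]
  intro ε hε
  have hgen : P.IsGen μ 2 U.1.1 U.1.2 := isGen_of_graph (hμ := hμ) Filter.EventuallyEq.rfl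
  obtain ⟨g, hg, h1, h2⟩ := hS.2 U.1.1 ⟨_, hgen⟩ ε hε
  obtain ⟨V, hV⟩ := exists_graph_of_mem_dom (hμ := hμ) (hS.1 hg)
  refine ⟨V, ⟨V.2, g, hg, hV⟩, ?_⟩
  rw [Prod.edist_eq, max_lt_iff, Lp.edist_def, Lp.edist_def]
  refine ⟨(eLpNorm_congr_ae ?_).trans_lt h1, (eLpNorm_congr_ae ?_).trans_lt h2⟩
  · exact Filter.EventuallyEq.rfl.sub hV
  · exact (gen_ae_eq_of_graph (U := U) Filter.EventuallyEq.rfl).symm.sub (gen_ae_eq_of_graph hV).symm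

/-- If some algebra is a core, products of functions in `D_2(L)` are in `D_1(L)`. -/
theorem IsCore.exists_isGenerator_mul {A : Subalgebra ℝ (E → ℝ)}
    (hA : P.IsCore μ (A : Set (E → ℝ))) (U V : hμ.onL2.graph) :
    ∃ k, hμ.onL1.IsGenerator (mulL μ U.1.1 V.1.1) k := by
  refine MarkovSemigroup.exists_isGenerator_mul (fun W hW => ?_) U V
  refine exists_isGenerator_sq_of_mem_closure (fun _ h => h.1) ?_ (hA.mem_closure ⟨W, hW⟩)
  rintro U ⟨-, f, hf, hUf⟩ V ⟨-, g, hg, hVg⟩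
  -- Within the algebra the product is itself in `D_2(L)`, hence in `D_1(L)`.
  obtain ⟨k, hk⟩ := hA.1 (A.mul_mem hf hg)
  have h := hμ.isGen_one_of_two hk
  refine ⟨h.2.1.toLp, ?_⟩
  convert (hμ.isGenerator_toLp_iff ENNReal.one_ne_top h.1 h.2.1).2 h using 1
  exact Lp.ext ((coeFn_mulL U.1 V.1).trans ((hUf.mul hVg).trans h.1.coeFn_toLp.symm))

variable {hmul : ∀ U V : hμ.onL2.graph, ∃ k, hμ.onL1.IsGenerator (mulL μ U.1.1 V.1.1) k}

theorem carre_ae_eq {U V : hμ.onL2.graph} {f g : E → ℝ} (hf : (U.1.1 : E → ℝ) =ᵐ[μ] f)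
    (hg : (V.1.1 : E → ℝ) =ᵐ[μ] g) : P.carre μ f g =ᵐ[μ] carreL hmul U V := by
  obtain ⟨k, hk⟩ := hmul U V
  rw [carreL_eq hk]
  have hfg : f * g =ᵐ[μ] mulL μ U.1.1 V.1.1 := ((coeFn_mulL _ _).trans (hf.mul hg)).symm
  filter_upwards [gen_ae_eq_of_isGenerator hfg hk, gen_ae_eq_of_graph hf, gen_ae_eq_of_graph hg,
    Lp.coeFn_sub (k - mulL μ U.1.1 V.1.2) (mulL μ V.1.1 U.1.2),
    Lp.coeFn_sub k (mulL μ U.1.1 V.1.2), coeFn_mulL U.1.1 V.1.2, coeFn_mulL V.1.1 U.1.2, hf, hg]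
    with x h1 h2 h3 h4 h5 h6 h7 h8 h9
  rw [h4, Pi.sub_apply, h5, Pi.sub_apply, h6, h7, carre, h1, h2, h3, Pi.mul_apply, Pi.mul_apply,
    h8, h9]

include hmul in
-- The product `u Lv` need not lie in `D_1(L)`, but it is an `L¹` limit of products of `u` with
-- difference quotients of `v`, which do. The product rule needs this regularity.
theorem isRegular_mulL (U V : hμ.onL2.graph) : hμ.onL1.IsRegular (mulL μ U.1.1 V.1.2) := by
  have h : Tendsto (fun t : ℝ≥0 => mulL μ U.1.1 ((t : ℝ)⁻¹ • (hμ.onL2 t V.1.1 - V.1.1)))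
      (𝓝[>] 0) (𝓝 (mulL μ U.1.1 V.1.2)) :=
    ((mulL μ U.1.1).continuous.tendsto _).comp V.2
  refine isClosed_isRegular.mem_of_tendsto h (Eventually.of_forall fun t => ?_)
  obtain ⟨k, hk⟩ := hmul U ((t : ℝ)⁻¹ • (hμ.onL2.graphSemigroup t V - V))
  exact hk.isRegular_left

theorem isRegular_carreL (U V : hμ.onL2.graph) : hμ.onL1.IsRegular (carreL hmul U V) := by
  obtain ⟨k, hk⟩ := hmul U V
  rw [carreL_eq hk]
  exact (hk.isRegular_right.sub (isRegular_mulL (hmul := hmul) U V)).sub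
    (isRegular_mulL (hmul := hmul) V U)

theorem IsInvariant.coeFn_graphSemigroup {U : hμ.onL2.graph} {f : E → ℝ}
    (hf : (U.1.1 : E → ℝ) =ᵐ[μ] f) (t : ℝ≥0) :
    ((hμ.onL2.graphSemigroup t U).1.1 : E → ℝ) =ᵐ[μ] P.op t f :=
  (hμ.coeFn_lpSemigroup ENNReal.ofNat_ne_top t U.1.1).trans (hμ.op_congr t hf)

/-- The curvature bound transferred from functions to classes in `L¹`, with `V` standing for `Lf`.
-/
theorem CurvatureBoundedBelow.exists_isGenerator {N : Set (E → ℝ)} (hN : P.IsNiceClass μ N) {ρ : ℝ}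
    (hρ : P.CurvatureBoundedBelow μ N ρ) {U V : hμ.onL2.graph} (hUV : U.1.2 = V.1.1) {f : E → ℝ}
    (hfN : f ∈ N) (hf : (U.1.1 : E → ℝ) =ᵐ[μ] f) :
    ∃ k, hμ.onL1.IsGenerator (carreL hmul U U) k ∧
      0 ≤ k - (2 : ℝ) • carreL hmul U V - ρ • carreL hmul U U := by
  obtain ⟨k, hk⟩ := hN.carre_mem f hfN
  have hΓ := carre_ae_eq (hmul := hmul) hf hf
  have hk' : hμ.onL1.IsGenerator (carreL hmul U U) hk.2.1.toLp := by
    convert (hμ.isGenerator_toLp_iff ENNReal.one_ne_top hk.1 hk.2.1).2 hk using 1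
    exact Lp.ext (hΓ.symm.trans hk.1.coeFn_toLp.symm)
  refine ⟨_, hk', ?_⟩
  have hgen : (V.1.1 : E → ℝ) =ᵐ[μ] P.gen μ f := by
    rw [← hUV]; exact (gen_ae_eq_of_graph hf).symm
  rw [← Lp.coeFn_nonneg]
  filter_upwards [hρ f hfN, gen_ae_eq_of_isGenerator hΓ hk', hΓ,
    carre_ae_eq (hmul := hmul) hf hgen,
    Lp.coeFn_sub (hk.2.1.toLp - (2 : ℝ) • carreL hmul U V) (ρ • carreL hmul U U),
    Lp.coeFn_sub hk.2.1.toLp ((2 : ℝ) • carreL hmul U V), Lp.coeFn_smul (2 : ℝ) (carreL hmul U V),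
    Lp.coeFn_smul ρ (carreL hmul U U)] with x h1 h2 h3 h4 h5 h6 h7 h8
  rw [h5, Pi.sub_apply, h6, Pi.sub_apply, h7, h8]
  rw [gammaTwo, h2, h3, h4] at h1
  simp only [Pi.zero_apply, Pi.smul_apply, smul_eq_mul]
  linarith

/-- Gradient bound along the semigroup for nice functions. -/
theorem CurvatureBoundedBelow.carreL_le_of_nice {N : Set (E → ℝ)} (hN : P.IsNiceClass μ N) {ρ : ℝ}
    (hρ : P.CurvatureBoundedBelow μ N ρ) {U : hμ.onL2.graph} {f : E → ℝ}
    (hfN : f ∈ N) (hf : (U.1.1 : E → ℝ) =ᵐ[μ] f) (t : ℝ≥0) :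
    carreL hmul (hμ.onL2.graphSemigroup t U) (hμ.onL2.graphSemigroup t U)
      ≤ Real.exp (-ρ * t) • hμ.onL1 t (carreL hmul U U) := by
  obtain ⟨V, hV⟩ := exists_graph_of_mem_dom (hμ := hμ) (hN.gen_mem f hfN)
  have hUV : U.1.2 = V.1.1 := Lp.ext ((gen_ae_eq_of_graph hf).symm.trans hV.symm)
  set S := hμ.onL2.graphSemigroup with hS
  have hUVt : ∀ u, (S u U).1.2 = (S u V).1.1 := fun u => by
    rw [hS, coe_graphSemigroup, coe_graphSemigroup]; exact congrArg (hμ.onL2 u) hUV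
  choose k hk hk0 using fun u : ℝ≥0 => hρ.exists_isGenerator (hmul := hmul) hN (hUVt u)
    (hN.op_mem f hfN u) (hμ.coeFn_graphSemigroup hf u)
  have hW : ∀ u ∈ Icc (0 : ℝ) t, HasDerivWithinAt (fun u : ℝ => S u.toNNReal U)
      (S u.toNNReal V) (Icc (0 : ℝ) t) u := fun u hu =>
    ((isGenerator_graphSemigroup hUV).hasDerivWithinAt hu.1).mono Icc_subset_Ici_self
  have hG : ∀ u ∈ Icc (0 : ℝ) t, HasDerivWithinAt
      (fun u : ℝ => carreL hmul (S u.toNNReal U) (S u.toNNReal U))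
      ((2 : ℝ) • carreL hmul (S u.toNNReal U) (S u.toNNReal V)) (Icc (0 : ℝ) t) u := by
    intro u hu
    refine ((carreL hmul).hasDerivWithinAt_of_bilinear (hW u hu) (hW u hu)).congr_deriv ?_
    rw [carreL_comm (S u.toNNReal V), two_smul]
  -- The interpolation runs from `Γ(P_t f)` at `s = 0` to `e^{-ρt} P_t Γ(f)` at `s = t`. As `N` is
  -- stable under the semigroup, the curvature bound applies to `P_{t-s} f`.
  have hφ : ∀ s ∈ Icc (0 : ℝ) t, HasDerivWithinAt
      (fun s : ℝ => Real.exp (-ρ * s) • hμ.onL1 s.toNNReal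
        (carreL hmul (S (t - s).toNNReal U) (S (t - s).toNNReal U)))
      (Real.exp (-ρ * s) • hμ.onL1 s.toNNReal (k (t - s).toNNReal
        - (2 : ℝ) • carreL hmul (S (t - s).toNNReal U) (S (t - s).toNNReal V)
        - ρ • carreL hmul (S (t - s).toNNReal U) (S (t - s).toNNReal U))) (Icc (0 : ℝ) t) s := by
    intro s hs
    have hs' : (t : ℝ) - s ∈ Icc (0 : ℝ) t := ⟨by linarith [hs.2], by linarith [hs.1]⟩
    have h1 := hasDerivWithinAt_apply_sub hs (hG _ hs') (hk _) ((isRegular_carreL _ _).smul 2)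
    have h2 : HasDerivWithinAt (fun s : ℝ => Real.exp (-ρ * s)) (Real.exp (-ρ * s) * -ρ)
        (Icc (0 : ℝ) t) s := by
      have := ((hasDerivWithinAt_id s (Icc (0 : ℝ) t)).const_mul (-ρ)).exp
      simpa using this
    refine (h2.smul h1).congr_deriv ?_
    simp only [map_sub, map_smul]
    module
  have := le_of_hasDerivWithinAt_nonneg t.coe_nonneg hφ fun s hs =>
    lp_smul_nonneg (Real.exp_pos _).le
      (by simpa using hμ.onL1_mono s.toNNReal (hk0 (t - s).toNNReal))
  simpa [ContractionSemigroup.zero_apply] using this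

/-- Gradient bound along the semigroup. -/
theorem CurvatureBoundedBelow.carreL_le {N : Set (E → ℝ)} (hN : P.IsNiceClass μ N) {ρ : ℝ}
    (hρ : P.CurvatureBoundedBelow μ N ρ) (U : hμ.onL2.graph) (t : ℝ≥0) :
    carreL hmul (hμ.onL2.graphSemigroup t U) (hμ.onL2.graphSemigroup t U)
      ≤ Real.exp (-ρ * t) • hμ.onL1 t (carreL hmul U U) := by
  obtain ⟨V, hV, hlim⟩ := mem_closure_iff_seq_limit.1 (hN.core.mem_closure U)
  let W : ℕ → hμ.onL2.graph := fun n => ⟨V n, (hV n).1⟩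
  have hW : Tendsto W atTop (𝓝 U) := tendsto_subtype_rng.2 hlim
  have hSW := ((hμ.onL2.graphSemigroup t).continuous.tendsto U).comp hW
  -- Both sides are continuous in graph norm, and nice functions are dense for it.
  refine le_of_tendsto_of_tendsto' (tendsto_bilinear_apply (carreL hmul) hSW hSW)
    ((((hμ.onL1 t).continuous.tendsto _).comp
      (tendsto_bilinear_apply (carreL hmul) hW hW)).const_smul (Real.exp (-ρ * t))) fun n => ?_
  obtain ⟨g, hgN, hg⟩ := (hV n).2
  exact hρ.carreL_le_of_nice hN (U := W n) hgN hg t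

theorem hasDerivAt_curvatureCoeff (ρ u : ℝ) :
    HasDerivAt (curvatureCoeff ρ) (Real.exp (-ρ * u)) u := by
  by_cases h : ρ = 0
  · have : curvatureCoeff ρ = id := by funext x; simp [curvatureCoeff, h]
    rw [this]
    simpa [h] using hasDerivAt_id u
  · have : curvatureCoeff ρ = fun x => (1 - Real.exp (-ρ * x)) / ρ := by
      funext x; simp [curvatureCoeff, h]
    rw [this]
    refine ((((hasDerivAt_id u).const_mul (-ρ)).exp.const_sub 1).div_const ρ).congr_deriv ?_
    simp only [id, mul_one]
    field_simp

theorem curvatureCoeff_zero (ρ : ℝ) : curvatureCoeff ρ 0 = 0 := by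
  simp [curvatureCoeff]

theorem curvatureCoeff_nonneg (ρ : ℝ) {t : ℝ} (ht : 0 ≤ t) : 0 ≤ curvatureCoeff ρ t := by
  have := monotone_of_deriv_nonneg (fun u => (hasDerivAt_curvatureCoeff ρ u).differentiableAt)
    (fun u => by rw [(hasDerivAt_curvatureCoeff ρ u).deriv]; positivity) ht
  rwa [curvatureCoeff_zero] at this

/-- Local Poincaré inequality. -/
theorem CurvatureBoundedBelow.local_poincare {N : Set (E → ℝ)} (hN : P.IsNiceClass μ N) {ρ : ℝ}
    (hρ : P.CurvatureBoundedBelow μ N ρ) (U : hμ.onL2.graph) (t : ℝ≥0) :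
    hμ.onL1 t (mulL μ U.1.1 U.1.1) - mulL μ (hμ.onL2 t U.1.1) (hμ.onL2 t U.1.1)
      ≤ curvatureCoeff ρ t • hμ.onL1 t (carreL hmul U U) := by
  set K := hμ.onL1 t (carreL hmul U U) with hK
  set S := hμ.onL2.graphSemigroup with hS
  have hH : ∀ u ∈ Icc (0 : ℝ) t, HasDerivWithinAt
      (fun u : ℝ => mulL μ (hμ.onL2 u.toNNReal U.1.1) (hμ.onL2 u.toNNReal U.1.1))
      ((2 : ℝ) • mulL μ (hμ.onL2 u.toNNReal U.1.1) (hμ.onL2 u.toNNReal U.1.2))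
      (Icc (0 : ℝ) t) u := by
    intro u hu
    have h := (IsGenerator.hasDerivWithinAt U.2 hu.1).mono
      (Icc_subset_Ici_self : Icc (0 : ℝ) t ⊆ Ici 0)
    refine ((mulL μ).hasDerivWithinAt_of_bilinear h h).congr_deriv ?_
    rw [mulL_comm (hμ.onL2 u.toNNReal U.1.2), two_smul]
  -- Since `c(0) = 0` and `c'(u) = e^{-ρu}`, this curve runs from `-c(t) K - (P_t f)²` to
  -- `-P_t(f²)`, and its derivative compares `P_s Γ(P_{t-s} f)` with `e^{-ρ(t-s)} P_s P_{t-s} Γ(f) =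
  -- e^{-ρ(t-s)} K`.
  have hθ : ∀ s ∈ Icc (0 : ℝ) t, HasDerivWithinAt
      (fun s : ℝ => -curvatureCoeff ρ (t - s) • K - hμ.onL1 s.toNNReal
        (mulL μ (hμ.onL2 (t - s).toNNReal U.1.1) (hμ.onL2 (t - s).toNNReal U.1.1)))
      (Real.exp (-ρ * (t - s)) • K
        - hμ.onL1 s.toNNReal (carreL hmul (S (t - s).toNNReal U) (S (t - s).toNNReal U)))
      (Icc (0 : ℝ) t) s := by
    intro s hs
    have hs' : (t : ℝ) - s ∈ Icc (0 : ℝ) t := ⟨by linarith [hs.2], by linarith [hs.1]⟩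
    have h1 := hasDerivWithinAt_apply_sub hs (hH _ hs')
      (isGenerator_mulL (hmul := hmul) (S (t - s).toNNReal U))
      ((isRegular_mulL (hmul := hmul) (S (t - s).toNNReal U) (S (t - s).toNNReal U)).smul 2)
    have h2 : HasDerivWithinAt (fun s : ℝ => -curvatureCoeff ρ (t - s)) (Real.exp (-ρ * (t - s)))
        (Icc (0 : ℝ) t) s := by
      have := ((hasDerivAt_curvatureCoeff ρ (t - s)).comp s
        ((hasDerivAt_id s).const_sub (t : ℝ))).neg.hasDerivWithinAt (s := Icc (0 : ℝ) t)
      exact this.congr_deriv (by simp)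
    refine ((h2.smul_const K).sub h1).congr_deriv ?_
    congr 2
    exact add_sub_cancel_right _ _
  have h := le_of_hasDerivWithinAt_nonneg t.coe_nonneg hθ fun s hs => by
    rw [sub_nonneg]
    have h1 := hμ.onL1_mono s.toNNReal (hρ.carreL_le (hmul := hmul) hN U (t - s).toNNReal)
    have h2 : ((t - s).toNNReal : ℝ) = t - s := Real.coe_toNNReal _ (by linarith [hs.2])
    have h3 : s.toNNReal + (t - s).toNNReal = t := by
      rw [← Real.toNNReal_add hs.1 (by linarith [hs.2]), add_sub_cancel, Real.toNNReal_coe]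
    rwa [map_smul, ← ContractionSemigroup.add_apply, h3, h2] at h1
  simp only [sub_zero, sub_self, Real.toNNReal_coe, Real.toNNReal_zero,
    ContractionSemigroup.zero_apply, curvatureCoeff_zero, neg_zero, zero_smul, zero_sub] at h
  rw [← sub_nonneg] at h ⊢
  convert h using 1
  module

end MarkovSemigroup

/-! ### Bounded functions: oscillation and variance under the kernel -/

namespace MarkovSemigroup

open ContractionSemigroup

variable {E : Type*} [MeasurableSpace E] {P : MarkovSemigroup E} {μ : Measure E}

theorem osc_nonneg {E : Type*} {f : E → ℝ} {C : ℝ} (hf : ∀ x, |f x| ≤ C) : 0 ≤ osc f := by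
  rcases isEmpty_or_nonempty E with hE | ⟨⟨x⟩⟩
  · simp [osc]
  have hA : BddAbove (range f) := ⟨C, by rintro _ ⟨x, rfl⟩; exact (abs_le.1 (hf x)).2⟩
  have hB : BddBelow (range f) := ⟨-C, by rintro _ ⟨x, rfl⟩; exact (abs_le.1 (hf x)).1⟩
  exact sub_nonneg.2 ((ciInf_le hB x).trans (le_ciSup hA x))

theorem integrable_of_bdd {ν : Measure E} [IsFiniteMeasure ν] {f : E → ℝ} (hm : Measurable f)
    {C : ℝ} (hf : ∀ x, |f x| ≤ C) : Integrable f ν :=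
  Integrable.of_bound hm.aestronglyMeasurable C (Eventually.of_forall hf)

theorem osc_op_le [Nonempty E] {f : E → ℝ} (hm : Measurable f) {C : ℝ} (hf : ∀ x, |f x| ≤ C)
    (t : ℝ≥0) : osc (P.op t f) ≤ osc f := by
  have hA : BddAbove (range f) := ⟨C, by rintro _ ⟨x, rfl⟩; exact (abs_le.1 (hf x)).2⟩
  have hB : BddBelow (range f) := ⟨-C, by rintro _ ⟨x, rfl⟩; exact (abs_le.1 (hf x)).1⟩
  refine sub_le_sub (ciSup_le fun x => ?_) (le_ciInf fun x => ?_)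
  · have := integral_mono (μ := P.kernel t x) (integrable_of_bdd hm hf)
      (integrable_const (⨆ x, f x)) (fun y => le_ciSup hA y)
    rw [integral_const, probReal_univ, one_smul] at this
    exact this
  · have := integral_mono (μ := P.kernel t x) (integrable_const (⨅ x, f x))
      (integrable_of_bdd hm hf) (fun y => ciInf_le hB y)
    rw [integral_const, probReal_univ, one_smul] at this
    exact this

theorem abs_op_le {f : E → ℝ} {C : ℝ} (hf : ∀ x, |f x| ≤ C) (t : ℝ≥0) (x : E) :
    |P.op t f x| ≤ C := by
  have := norm_integral_le_of_norm_le_const (μ := P.kernel t x) (f := f) (C := C)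
    (Eventually.of_forall hf)
  rwa [probReal_univ, mul_one] at this

theorem measurable_op {f : E → ℝ} (hm : Measurable f) (t : ℝ≥0) : Measurable (P.op t f) :=
  (hm.stronglyMeasurable.integral_kernel (κ := P.kernel t)).measurable

theorem integrable_op {ν : Measure E} (t : ℝ≥0) {f : E → ℝ}
    (hf : Integrable f (P.kernel t ∘ₘ ν)) : Integrable (P.op t f) ν := by
  rw [Measure.comp_eq_comp_const_apply] at hf
  have h := hf.integral_comp
  rwa [Kernel.const_apply] at h

/-- The law of total variance, conditioning on the starting point. -/
theorem variance_comp_kernel {ν : Measure E} [IsProbabilityMeasure ν] {f : E → ℝ}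
    (hm : Measurable f) {C : ℝ} (hf : ∀ x, |f x| ≤ C) (t : ℝ≥0) :
    variance f (P.kernel t ∘ₘ ν) = ∫ x, (P.op t (f * f) x - P.op t f x * P.op t f x) ∂ν
      + variance (P.op t f) ν := by
  have hm2 : Measurable (f * f) := hm.mul hm
  have hf2 : ∀ x, |(f * f) x| ≤ C * C := fun x => by
    rw [Pi.mul_apply, abs_mul]
    exact mul_le_mul (hf x) (hf x) (abs_nonneg _) ((abs_nonneg _).trans (hf x))
  have hgm := measurable_op (P := P) hm t
  have hg := abs_op_le (P := P) hf t
  have hg2 : ∀ x, |P.op t f x * P.op t f x| ≤ C * C := fun x => by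
    rw [abs_mul]
    exact mul_le_mul (hg x) (hg x) (abs_nonneg _) ((abs_nonneg _).trans (hg x))
  have hmem : MemLp f 2 (P.kernel t ∘ₘ ν) :=
    MemLp.of_bound hm.aestronglyMeasurable C (Eventually.of_forall hf)
  have hmem' : MemLp (P.op t f) 2 ν :=
    MemLp.of_bound hgm.aestronglyMeasurable C (Eventually.of_forall hg)
  rw [variance_eq_sub hmem, variance_eq_sub hmem', sq f, sq (P.op t f),
    integral_comp_kernel t (integrable_of_bdd hm2 hf2),
    integral_comp_kernel t (integrable_of_bdd hm hf)]
  have := integral_sub (μ := ν) (integrable_of_bdd (measurable_op (P := P) hm2 t)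
      (abs_op_le hf2 t))
    (integrable_of_bdd (f := fun x => P.op t f x * P.op t f x) (hgm.mul hgm) hg2)
  rw [this]
  simp only [Pi.mul_apply]
  ring

end MarkovSemigroup

theorem IsProbDensity.isProbabilityMeasure {E : Type*} [MeasurableSpace E] {μ : Measure E}
    {h : E → ℝ} (hh : IsProbDensity μ h) : IsProbabilityMeasure (densityMeasure μ h) := by
  refine ⟨?_⟩
  rw [densityMeasure, withDensity_apply _ MeasurableSet.univ, Measure.restrict_univ,
    ← ofReal_integral_eq_lintegral_ofReal hh.1 hh.2.1, hh.2.2, ENNReal.ofReal_one]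

/-! ### Transfer of the weak Poincaré inequality -/

namespace MarkovSemigroup

open ContractionSemigroup

variable {E : Type*} [MeasurableSpace E] {P : MarkovSemigroup E} {μ : Measure E}

/-- Since `hμ ≪ μ` and `μ` is invariant, the law at time `t` is absolutely continuous, so its
Radon-Nikodym density recovers it. -/
theorem IsInvariant.densityMeasure_dual [SigmaFinite μ] (hμ : P.IsInvariant μ) (t : ℝ≥0)
    {h : E → ℝ} (hh : IsProbDensity μ h) :
    densityMeasure μ (P.dual μ t h) = P.kernel t ∘ₘ densityMeasure μ h := by
  have := hh.isProbabilityMeasure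
  have hac : P.kernel t ∘ₘ densityMeasure μ h ≪ μ := by
    have h1 : densityMeasure μ h ≪ μ := withDensity_absolutelyContinuous _ _
    have h2 := h1.comp_right (P.kernel t)
    rwa [hμ.comp_eq t] at h2
  conv_rhs => rw [← Measure.withDensity_rnDeriv_eq _ _ hac]
  refine withDensity_congr_ae ?_
  filter_upwards [Measure.rnDeriv_lt_top (P.kernel t ∘ₘ densityMeasure μ h) μ] with x hx
  exact ENNReal.ofReal_toReal hx.ne

/-- Under a lower bound on the curvature, the law of the process inherits a weak Poincaré inequality
from its initial law. -/
theorem CurvatureBoundedBelow.weakPoincare_dual [IsProbabilityMeasure μ] (hμ : P.IsInvariant μ)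
    {A : Subalgebra ℝ (E → ℝ)} (hA_core : P.IsCore μ (A : Set (E → ℝ)))
    {N : Set (E → ℝ)} (hN : P.IsNiceClass μ N) {ρ : ℝ} (hρ : P.CurvatureBoundedBelow μ N ρ)
    {h : E → ℝ} (hh : IsProbDensity μ h) {β : ℝ → ℝ}
    (hβ : P.WeakPoincare μ (densityMeasure μ h) β) (t : ℝ≥0) :
    P.WeakPoincare μ (densityMeasure μ (P.dual μ t h))
      (fun s => curvatureCoeff ρ t + Real.exp (-ρ * t) * β s) := by
  obtain ⟨hβ0, hβa, hβp⟩ := hβ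
  have hc : 0 ≤ curvatureCoeff ρ t := curvatureCoeff_nonneg ρ t.coe_nonneg
  refine ⟨fun s hs => add_nonneg hc (mul_nonneg (Real.exp_pos _).le (hβ0 s hs)),
    fun a ha b hb hab => ?_, ?_⟩
  · exact add_le_add_right (mul_le_mul_of_nonneg_left (hβa ha hb hab) (Real.exp_pos _).le) _
  rw [hμ.densityMeasure_dual t hh]
  have := hh.isProbabilityMeasure
  have : Nonempty E := nonempty_of_isProbabilityMeasure μ
  set ν := densityMeasure μ h
  have hνμ : ν ≪ μ := withDensity_absolutelyContinuous _ _
  intro f hm ⟨C, hf⟩ hdom hint s hs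
  have hmul := hA_core.exists_isGenerator_mul (hμ := hμ)
  obtain ⟨U, hU⟩ := exists_graph_of_mem_dom (hμ := hμ) hdom
  have hg := hμ.coeFn_graphSemigroup hU t
  have hΓf := carre_ae_eq (hmul := hmul) hU hU
  have hΓg := carre_ae_eq (hmul := hmul) hg hg
  have hopΓ : P.op t (P.carre μ f f) =ᵐ[μ] hμ.onL1 t (carreL hmul U U) :=
    (hμ.op_congr t hΓf).trans (hμ.coeFn_lpSemigroup ENNReal.one_ne_top t _).symm
  have hΓg0 : ∀ᵐ x ∂μ, 0 ≤ P.carre μ (P.op t f) (P.op t f) x := by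
    filter_upwards [hΓg, (Lp.coeFn_nonneg _).2 (carreL_self_nonneg (hmul := hmul)
      (hμ.onL2.graphSemigroup t U))] with x h1 h2
    rwa [h1]
  have hgrad : ∀ᵐ x ∂μ, P.carre μ (P.op t f) (P.op t f) x
      ≤ Real.exp (-ρ * t) * P.op t (P.carre μ f f) x := by
    filter_upwards [hΓg, hopΓ, (Lp.coeFn_le _ _).2 (hρ.carreL_le (hmul := hmul) hN U t),
      Lp.coeFn_smul (Real.exp (-ρ * t)) (hμ.onL1 t (carreL hmul U U))] with x h1 h2 h3 h4
    rw [h1, h2]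
    rwa [h4] at h3
  have hloc : ∀ᵐ x ∂μ, P.op t (f * f) x - P.op t f x * P.op t f x
      ≤ curvatureCoeff ρ t * P.op t (P.carre μ f f) x := by
    have hsq : f * f =ᵐ[μ] mulL μ U.1.1 U.1.1 := ((coeFn_mulL _ _).trans (hU.mul hU)).symm
    filter_upwards [hopΓ, (Lp.coeFn_le _ _).2 (hρ.local_poincare (hmul := hmul) hN U t),
      Lp.coeFn_smul (curvatureCoeff ρ t) (hμ.onL1 t (carreL hmul U U)),
      Lp.coeFn_sub (hμ.onL1 t (mulL μ U.1.1 U.1.1)) (mulL μ (hμ.onL2 t U.1.1) (hμ.onL2 t U.1.1)),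
      hμ.op_congr t hsq, hμ.coeFn_lpSemigroup ENNReal.one_ne_top t (mulL μ U.1.1 U.1.1),
      coeFn_mulL (hμ.onL2 t U.1.1) (hμ.onL2 t U.1.1), hg] with x h1 h2 h3 h4 h5 h6 h7 h8
    rw [h3, h4, Pi.sub_apply, h7, Pi.mul_apply, Pi.smul_apply, smul_eq_mul, ← h1, h6, ← h5] at h2
    rw [coe_graphSemigroup] at h8
    rwa [← h8]
  have hint_op : Integrable (P.op t (P.carre μ f f)) ν := integrable_op t hint
  -- The gradient bound also supplies the finite energy of `P_t f` under `ν`, without which the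
  -- hypothesis on `ν` says nothing.
  have hint_g : Integrable (P.carre μ (P.op t f) (P.op t f)) ν := by
    refine (hint_op.const_mul (Real.exp (-ρ * t))).mono'
      (((Lp.aestronglyMeasurable _).congr hΓg.symm).mono_ac hνμ) ?_
    filter_upwards [hνμ.ae_le hΓg0, hνμ.ae_le hgrad] with x h1 h2
    rwa [Real.norm_of_nonneg h1]
  have hgb := abs_op_le (P := P) hf t
  have hpoin := hβp (P.op t f) (measurable_op hm t) ⟨C, hgb⟩ ⟨_, isGen_of_graph hg⟩ hint_g s hs
  have h1 : ∫ x, P.carre μ (P.op t f) (P.op t f) x ∂ν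
      ≤ Real.exp (-ρ * t) * ∫ x, P.op t (P.carre μ f f) x ∂ν := by
    rw [← integral_const_mul]
    exact integral_mono_ae hint_g (hint_op.const_mul _) (hνμ.ae_le hgrad)
  have h2 : ∫ x, (P.op t (f * f) x - P.op t f x * P.op t f x) ∂ν
      ≤ curvatureCoeff ρ t * ∫ x, P.op t (P.carre μ f f) x ∂ν := by
    rw [← integral_const_mul]
    -- Nonnegativity of the conditional variance spares its integrability.
    refine integral_mono_of_nonneg ?_ (hint_op.const_mul _) (hνμ.ae_le hloc)
    filter_upwards [hνμ.ae_le (hμ.sq_op_le t ((memLp_congr_ae hU).1 (Lp.memLp _)))] with x hx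
    exact sub_nonneg.2 hx
  have h3 : osc (P.op t f) ^ 2 ≤ osc f ^ 2 := pow_le_pow_left₀ (osc_nonneg hgb) (osc_op_le hm hf t) 2
  rw [variance_comp_kernel hm hf t, integral_comp_kernel t hint]
  have h4 := mul_le_mul_of_nonneg_left h1 (hβ0 s hs)
  have h5 := mul_le_mul_of_nonneg_left h3 hs.le
  linarith

end MarkovSemigroup

end

theorem corollary5p2 {E : Type*} [MeasurableSpace E] (P : MarkovSemigroup E)
    (μ : Measure E) [IsProbabilityMeasure μ] (hμ : P.IsInvariant μ)
    (A : Subalgebra ℝ (E → ℝ)) (hA_bdd : ∀ f ∈ A, Measurable f ∧ ∃ C, ∀ x, |f x| ≤ C)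
    (hA_core : P.IsCore μ (A : Set (E → ℝ)))
    (N : Set (E → ℝ)) (hN : P.IsNiceClass μ N)
    (ρ : ℝ) (hρ : P.CurvatureBoundedBelow μ N ρ)
    (h : E → ℝ) (hh : IsProbDensity μ h)
    (β : ℝ → ℝ) (hβ : P.WeakPoincare μ (densityMeasure μ h) β) (t : ℝ≥0) :
    P.WeakPoincare μ (densityMeasure μ (P.dual μ t h))
      (fun s => curvatureCoeff ρ t + Real.exp (-ρ * t) * β s) := by
  exact hρ.weakPoincare_dual hμ hA_core hN hh hβ t
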